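/- Let $G$ be a compact, second countable (Hausdorff) topological group with Haar probability measure, and let $A$ be a Polish Abelian group on which $G$ acts continuously by automorphisms. For $p\ge 0$ let $\mathcal{C}^p(G,A)$ be the group of Haar-a.e. equivalence classes of Borel maps $G^p\to A$ (so $\mathcal{C}^0(G,A)=A$), with the topology of convergence in probability, and let $d:\mathcal{C}^p(G,A)\to\mathcal{C}^{p+1}(G,A)$ be the coboundary map \[ d\phi(g_1,\dots,g_{p+1}) = g_1\cdot\phi(g_2,\dots,g_{p+1})+\sum_{i=1}^{p}(-1)^i\phi(g_1,\dots,g_ig_{i+1},\dots,g_{p+1})+(-1)^{p+1}\phi(g_1,\dots,g_p). \] Put $\mathcal{Z}^p(G,A)=\ker\big(d|_{\mathcal{C}^p(G,A)}\big)$, $\mathcal{B}^p(G,A)=d\big(\mathcal{C}^{p-1}(G,A)\big)$ for $p\ge 1$, $\mathcal{B}^0(G,A)=(0)$, and $\mathrm{H}^p_{\mathrm m}(G,A)=\mathcal{Z}^p(G,A)/\mathcal{B}^p(G,A)$ with the quotient of the subspace topology of $\mathcal{Z}^p(G,A)$. Suppose that either $A$ is discrete (hence countable) and $p\ge 0$,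 or $A$ is toral, that is, isomorphic as a topological group to $(\mathbb{R}/\mathbb{Z})^n$ for some $n\ge 0$, and $p\ge 1$. Then $\mathcal{B}^p(G,A)$ is a clopen subgroup of $\mathcal{Z}^p(G,A)$, and $\mathrm{H}^p_{\mathrm m}(G,A)$ is discrete and countable in its quotient topology. -/

import Mathlib

open MeasureTheory Topology
open scoped ENNReal

namespace MeasurableCohomology

section Haar

variable (G : Type*) [Group G] [TopologicalSpace G] [IsTopologicalGroup G] [CompactSpace G]
  [T2Space G] [SecondCountableTopology G] [MeasurableSpace G] [BorelSpace G]

/-- The Haar probability measure of a compact group. -/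
noncomputable def haarProb : Measure G :=
  Measure.haarMeasure (⊤ : TopologicalSpace.PositiveCompacts G)

instance : IsProbabilityMeasure (haarProb G) :=
  ⟨by simpa [haarProb] using Measure.haarMeasure_self (K₀ := (⊤ : TopologicalSpace.PositiveCompacts G))⟩

instance : (haarProb G).IsHaarMeasure := by
  unfold haarProb; infer_instance

/-- The Haar probability measure of `G ^ p`, as a product measure. -/
noncomputable def haarPow (p : ℕ) : Measure (Fin p → G) :=
  Measure.pi fun _ => haarProb G

instance (p : ℕ) : IsProbabilityMeasure (haarPow G p) := by
  unfold haarPow; infer_instance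

instance (p : ℕ) : (haarPow G p).IsHaarMeasure := by
  unfold haarPow; infer_instance

variable {G}

/-- A measurable map between powers of `G` which intertwines left translations, in the sense that
every left translation of the target lifts to the source, preserves the Haar probability. -/
theorem measurePreserving_of_translation {p q : ℕ} (F : (Fin p → G) → (Fin q → G))
    (hF : Measurable F) (h : ∀ x : Fin q → G, ∃ y : Fin p → G, ∀ g, F (y * g) = x * F g) :
    MeasurePreserving F (haarPow G p) (haarPow G q) := by
  refine ⟨hF, ?_⟩
  have : IsProbabilityMeasure ((haarPow G p).map F) :=
    Measure.isProbabilityMeasure_map hF.aemeasurable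
  have hinv : ((haarPow G p).map F).IsMulLeftInvariant := by
    refine ⟨fun x => ?_⟩
    obtain ⟨y, hy⟩ := h x
    rw [Measure.map_map (measurable_const_mul x) hF]
    have : (fun z => x * z) ∘ F = F ∘ fun g => y * g := by
      funext g; exact (hy g).symm
    rw [this, ← Measure.map_map hF (measurable_const_mul y), map_mul_left_eq_self]
  have : ((haarPow G p).map F).IsHaarMeasure :=
    Measure.isHaarMeasure_of_isCompact_nonempty_interior _ Set.univ isCompact_univ (by simp)
      (by simp) (by simp)
  exact Measure.isHaarMeasure_eq_of_isProbabilityMeasure _ _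

/-- The map `(g₁, …, gₚ₊₁) ↦ (g₂, …, gₚ₊₁)` preserves the Haar probability. -/
theorem measurePreserving_tail (p : ℕ) :
    MeasurePreserving (fun (g : Fin (p + 1) → G) (i : Fin p) => g i.succ)
      (haarPow G (p + 1)) (haarPow G p) := by
  refine measurePreserving_of_translation _
    (measurable_pi_lambda _ fun i => measurable_pi_apply _)
    fun x => ⟨Fin.cons (α := fun _ => G) 1 x, fun g => ?_⟩
  funext i
  simp

/-- The maps `(g₁, …, gₚ₊₁) ↦ (g₁, …, gᵢgᵢ₊₁, …, gₚ₊₁)` and `(g₁, …, gₚ₊₁) ↦ (g₁, …, gₚ)`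
preserve the Haar probability. -/
theorem measurePreserving_contractNth (p : ℕ) (j : Fin (p + 1)) :
    MeasurePreserving (fun g : Fin (p + 1) → G => Fin.contractNth j (· * ·) g)
      (haarPow G (p + 1)) (haarPow G p) := by
  refine measurePreserving_of_translation _ (measurable_pi_lambda _ fun k => ?_)
    fun x => ⟨fun i => if h : (i : ℕ) ≤ j ∧ (i : ℕ) < p then x ⟨i, h.2⟩ else
      if h : (j : ℕ) + 1 < i then x ⟨i - 1, by omega⟩ else 1, fun g => ?_⟩
  · unfold Fin.contractNth
    split_ifs <;> fun_prop
  · funext k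
    have hk := k.2
    rcases lt_trichotomy (k : ℕ) j with h | h | h
    · simp only [Fin.contractNth_apply_of_lt _ _ _ _ h, Pi.mul_apply, Fin.val_castSucc]
      rw [dif_pos ⟨h.le, hk⟩]
    · simp [Fin.contractNth_apply_of_eq _ _ _ _ h, ← h, mul_assoc]
    · have h' : ¬ ((k : ℕ) + 1 ≤ j ∧ (k : ℕ) + 1 < p) := by omega
      simp only [Fin.contractNth_apply_of_gt _ _ _ _ h, Pi.mul_apply, Fin.val_succ]
      rw [dif_neg h', dif_pos (by omega)]
      rfl

end Haar

section BarDifferential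

universe u v

variable {G : Type u} {A : Type v} [Group G] [AddCommGroup A] [DistribMulAction G A]

/-- The differential of the inhomogeneous bar resolution on functions `G ^ p → A`. With
`g = (g₁, …, gₚ₊₁)`, indexed from `0`, the tuple `Fin.contractNth j (· * ·) g` is
`(g₁, …, gⱼ₊₁gⱼ₊₂, …, gₚ₊₁)` for `j < p`, and `(g₁, …, gₚ)` for `j = p`. -/
def barDiff {p : ℕ} (f : (Fin p → G) → A) (g : Fin (p + 1) → G) : A :=
  g 0 • f (fun i => g i.succ) +
    ∑ j : Fin (p + 1), (-1 : ℤ) ^ ((j : ℕ) + 1) • f (Fin.contractNth j (· * ·) g)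

theorem barDiff_add {p : ℕ} (f f' : (Fin p → G) → A) :
    barDiff (f + f') = barDiff f + barDiff f' := by
  funext g
  simp [barDiff, Finset.sum_add_distrib, add_add_add_comm]

theorem barDiff_barDiff {p : ℕ} (f : (Fin p → G) → A) : barDiff (barDiff f) = 0 := by
  let ρ : Representation (ULift.{max u v} ℤ) (ULift.{max u v} G) (ULift.{max u v} A) :=
    { toFun := fun g =>
        { toFun := fun a => ⟨g.down • a.down⟩
          map_add' := fun a b => by ext; simp
          map_smul' := fun n a => by
            ext
            exact (smul_comm n.down g.down a.down).symm }
      map_one' := by ext; simp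
      map_mul' := fun g h => by ext; simp [mul_smul] }
  let F : ∀ {q : ℕ}, ((Fin q → G) → A) → (Fin q → ULift.{max u v} G) → ULift.{max u v} A :=
    fun f g => ⟨f fun i => (g i).down⟩
  have key : ∀ {q : ℕ} (f : (Fin q → G) → A),
      (inhomogeneousCochains.d (Rep.of ρ) q).hom (F f) = F (barDiff f) := by
    intro q f
    funext g
    apply ULift.down_injective
    simp only [inhomogeneousCochains.d_hom_apply]
    have hc : ∀ j : Fin (q + 1), (fun i => (Fin.contractNth j (· * ·) g i).down) =
        Fin.contractNth j (· * ·) fun i => (g i).down := fun j =>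
      Fin.comp_contractNth (· * ·) (· * ·) (f := ULift.down) (fun _ _ => rfl) j g
    have hs : ∀ n : ℕ, ((-1 : ULift.{max u v} ℤ) ^ n).down = (-1 : ℤ) ^ n := fun n =>
      map_pow (ULift.ringEquiv : ULift.{max u v} ℤ ≃+* ℤ) (-1) n
    rw [ULift.add_down]
    refine congrArg₂ (· + ·) rfl ?_
    refine (map_sum (AddEquiv.ulift : ULift.{max u v} A ≃+ A) _ _).trans
      (Finset.sum_congr rfl fun j _ => ?_)
    change ((-1 : ULift.{max u v} ℤ) ^ ((j : ℕ) + 1)).down •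
      f (fun i => (Fin.contractNth j (· * ·) g i).down) = _
    rw [hs, hc]
  have h := congrArg (fun φ => φ.hom (F f))
    (groupCohomology.inhomogeneousCochains.d_comp_d (A := Rep.of ρ) (n := p))
  have h2 : F (barDiff (barDiff f)) = 0 := by
    rw [← key, ← key]
    exact h
  funext g
  exact congrArg ULift.down (congrFun h2 fun i => ⟨g i⟩)

end BarDifferential

section Cochains

variable (G : Type*) [Group G] [TopologicalSpace G] [IsTopologicalGroup G] [CompactSpace G]
  [T2Space G] [SecondCountableTopology G] [MeasurableSpace G] [BorelSpace G]
  (A : Type*) [AddCommGroup A] [TopologicalSpace A] [IsTopologicalAddGroup A]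

/-- The group `𝒞ᵖ(G, A)` of classes, modulo Haar-almost-everywhere equality, of (strongly)
measurable maps `G ^ p → A`. -/
def Cochain (p : ℕ) : Type _ := (Fin p → G) →ₘ[haarPow G p] A

noncomputable instance (p : ℕ) : AddCommGroup (Cochain G A p) :=
  inferInstanceAs (AddCommGroup ((Fin p → G) →ₘ[haarPow G p] A))

noncomputable instance (p : ℕ) : CoeFun (Cochain G A p) fun _ => (Fin p → G) → A :=
  ⟨fun φ => AEEqFun.cast (μ := haarPow G p) φ⟩

variable {G A}

/-- The cochains `φ` with `m {g | φ(g) ∉ U} < ε`. -/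
def smallCochains (p : ℕ) (U : Set A) (ε : ℝ≥0∞) : Set (Cochain G A p) :=
  {φ | haarPow G p {g | φ g ∉ U} < ε}

theorem smallCochains_mono {p : ℕ} {U V : Set A} (hUV : U ⊆ V) {ε δ : ℝ≥0∞} (h : ε ≤ δ) :
    smallCochains (G := G) p U ε ⊆ smallCochains p V δ := fun φ hφ =>
  ((measure_mono fun g (hg : φ g ∉ V) => fun hU => hg (hUV hU)).trans_lt hφ).trans_le h

variable (G A)

/-- The neighbourhoods of `0` for convergence in probability: they are generated by the sets
`{φ | m {g | φ(g) ∉ U} < ε}` with `U` a neighbourhood of `0` in `A` and `ε > 0`. -/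
@[reducible]
noncomputable def cochainBasis (p : ℕ) : AddGroupFilterBasis (Cochain G A p) :=
  addGroupFilterBasisOfComm
    {S | ∃ U ∈ 𝓝 (0 : A), ∃ ε : ℝ≥0∞, 0 < ε ∧ S = smallCochains p U ε}
    ⟨_, Set.univ, Filter.univ_mem, 1, one_pos, rfl⟩
    (by
      rintro _ _ ⟨U, hU, ε, hε, rfl⟩ ⟨V, hV, δ, hδ, rfl⟩
      exact ⟨_, ⟨U ∩ V, Filter.inter_mem hU hV, min ε δ, lt_min hε hδ, rfl⟩,
        Set.subset_inter (smallCochains_mono Set.inter_subset_left (min_le_left _ _))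
          (smallCochains_mono Set.inter_subset_right (min_le_right _ _))⟩)
    (by
      rintro _ ⟨U, hU, ε, hε, rfl⟩
      have : haarPow G p {g | (0 : Cochain G A p) g ∉ U} = 0 := by
        have h0 : ∀ᵐ g ∂haarPow G p, (0 : Cochain G A p) g ∈ U := by
          filter_upwards [AEEqFun.coeFn_zero (μ := haarPow G p) (β := A)] with g hg
          have hg' : (0 : Cochain G A p) g = 0 := hg
          rw [hg']
          exact mem_of_mem_nhds hU
        exact h0
      change _ < ε
      rwa [this])
    (by
      rintro _ ⟨U, hU, ε, hε, rfl⟩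
      obtain ⟨V, hV, hVU⟩ := exists_nhds_zero_half hU
      refine ⟨_, ⟨V, hV, ε / 2, ENNReal.half_pos hε.ne', rfl⟩, ?_⟩
      rintro _ ⟨φ, hφ, ψ, hψ, rfl⟩
      have hle : haarPow G p {g | (φ + ψ) g ∉ U} ≤
          haarPow G p ({g | φ g ∉ V} ∪ {g | ψ g ∉ V}) := by
        refine measure_mono_ae ?_
        filter_upwards [AEEqFun.coeFn_add (μ := haarPow G p) φ ψ] with g hg hgU
        have hg' : (φ + ψ) g = φ g + ψ g := hg
        by_contra hcon
        have hcon' : ¬ (φ g ∉ V ∨ ψ g ∉ V) := hcon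
        push Not at hcon'
        exact hgU (by rw [hg']; exact hVU _ hcon'.1 _ hcon'.2)
      calc haarPow G p {g | (φ + ψ) g ∉ U} ≤ _ := hle
        _ ≤ _ := measure_union_le _ _
        _ < ε / 2 + ε / 2 := ENNReal.add_lt_add hφ hψ
        _ = ε := ENNReal.add_halves ε)
    (by
      rintro _ ⟨U, hU, ε, hε, rfl⟩
      refine ⟨_, ⟨-U, neg_mem_nhds_zero A hU, ε, hε, rfl⟩, fun φ hφ => ?_⟩
      refine lt_of_le_of_lt (measure_mono_ae ?_) hφ
      filter_upwards [AEEqFun.coeFn_neg (μ := haarPow G p) φ] with g hg hgU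
      have hg' : (-φ) g = -φ g := hg
      intro (h : φ g ∈ -U)
      exact hgU (by rw [hg']; exact h))

/-- The topology of convergence in probability. -/
noncomputable instance (p : ℕ) : TopologicalSpace (Cochain G A p) :=
  (cochainBasis G A p).topology

instance (p : ℕ) : IsTopologicalAddGroup (Cochain G A p) :=
  (cochainBasis G A p).isTopologicalAddGroup

variable [DistribMulAction G A] [ContinuousSMul G A]

variable {G A}

theorem aestronglyMeasurable_barDiff {p : ℕ} (φ : Cochain G A p) :
    AEStronglyMeasurable (barDiff φ) (haarPow G (p + 1)) := by
  have hφ : AEStronglyMeasurable φ (haarPow G p) :=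
    AEEqFun.aestronglyMeasurable (μ := haarPow G p) φ
  have h1 : AEStronglyMeasurable (fun g : Fin (p + 1) → G => g 0) (haarPow G (p + 1)) :=
    (measurable_pi_apply 0).stronglyMeasurable.aestronglyMeasurable
  have h2 := h1.smul
    (hφ.comp_quasiMeasurePreserving (measurePreserving_tail (G := G) p).quasiMeasurePreserving)
  have h3 : ∀ j : Fin (p + 1), AEStronglyMeasurable (fun g : Fin (p + 1) → G =>
      (-1 : ℤ) ^ ((j : ℕ) + 1) • φ (Fin.contractNth j (· * ·) g)) (haarPow G (p + 1)) := fun j =>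
    (hφ.comp_quasiMeasurePreserving
      (measurePreserving_contractNth (G := G) p j).quasiMeasurePreserving).const_smul
        ((-1 : ℤ) ^ ((j : ℕ) + 1))
  exact h2.add (Finset.aestronglyMeasurable_fun_sum _ fun j _ => h3 j)

theorem barDiff_congr {p : ℕ} {f f' : (Fin p → G) → A} (h : f =ᵐ[haarPow G p] f') :
    barDiff f =ᵐ[haarPow G (p + 1)] barDiff f' := by
  have h0 := (measurePreserving_tail (G := G) p).quasiMeasurePreserving.ae_eq_comp h
  have hj := ae_all_iff.2 fun j : Fin (p + 1) =>
    (measurePreserving_contractNth (G := G) p j).quasiMeasurePreserving.ae_eq_comp h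
  filter_upwards [h0, hj] with g hg0 hgj
  simp only [Function.comp_apply] at hg0 hgj
  simp only [barDiff, hg0, hgj]

variable (G A)

/-- The coboundary map `d : 𝒞ᵖ(G, A) → 𝒞ᵖ⁺¹(G, A)`. -/
noncomputable def d (p : ℕ) : Cochain G A p →+ Cochain G A (p + 1) :=
  AddMonoidHom.mk'
    (fun φ => (AEEqFun.mk (barDiff φ) (aestronglyMeasurable_barDiff φ) :
      (Fin (p + 1) → G) →ₘ[haarPow G (p + 1)] A))
    (by
      intro φ ψ
      refine AEEqFun.ext (((AEEqFun.coeFn_mk _ _).trans (barDiff_congr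
        (AEEqFun.coeFn_add (μ := haarPow G p) φ ψ))).trans ?_)
      refine Filter.EventuallyEq.trans ?_ (AEEqFun.coeFn_add (μ := haarPow G (p + 1)) _ _).symm
      rw [barDiff_add]
      exact ((AEEqFun.coeFn_mk _ _).add (AEEqFun.coeFn_mk _ _)).symm)

/-- Almost everywhere, `d φ` is given by the bar formula applied to any representative. -/
theorem d_ae_eq {p : ℕ} (φ : Cochain G A p) {f : (Fin p → G) → A} (h : φ =ᵐ[haarPow G p] f) :
    d G A p φ =ᵐ[haarPow G (p + 1)] barDiff f :=
  (AEEqFun.coeFn_mk _ _).trans (barDiff_congr h)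

theorem d_d {p : ℕ} (φ : Cochain G A p) : d G A (p + 1) (d G A p φ) = 0 := by
  refine AEEqFun.ext ((d_ae_eq G A _ (d_ae_eq G A φ (Filter.EventuallyEq.refl _ _))).trans ?_)
  rw [barDiff_barDiff]
  exact (AEEqFun.coeFn_zero (μ := haarPow G (p + 2)) (β := A)).symm

/-- The measurable cocycles `𝒵ᵖ(G, A)`. -/
noncomputable def cocycles (p : ℕ) : AddSubgroup (Cochain G A p) :=
  (d G A p).ker

/-- The measurable coboundaries `ℬᵖ(G, A)`; by convention there are no nonzero ones in
degree `0`. -/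
noncomputable def coboundaries : (p : ℕ) → AddSubgroup (Cochain G A p)
  | 0 => ⊥
  | p + 1 => (d G A p).range

theorem coboundaries_le_cocycles (p : ℕ) : coboundaries G A p ≤ cocycles G A p := by
  cases p with
  | zero => exact bot_le
  | succ p =>
    rintro _ ⟨φ, rfl⟩
    exact d_d G A φ

/-- The coboundaries, as a subgroup of the topological group of cocycles. -/
noncomputable def coboundariesInCocycles (p : ℕ) : AddSubgroup (cocycles G A p) :=
  (coboundaries G A p).addSubgroupOf (cocycles G A p)

/-- The measurable cohomology group `𝒵ᵖ(G, A) / ℬᵖ(G, A)`. It carries the quotient of the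
topology induced on `𝒵ᵖ(G, A)` by convergence in probability. -/
abbrev H (p : ℕ) : Type _ := cocycles G A p ⧸ coboundariesInCocycles G A p

end Cochains

end MeasurableCohomology

set_option linter.unusedSectionVars false

/-! Everything rests on one claim: a cocycle close enough to `0` in probability is a coboundary. The
coboundaries then contain a neighbourhood of `0` in the group of cocycles, so they form an open,
hence clopen, subgroup with discrete quotient. Since cochains fall into countably many classes of
mutually close ones, the quotient is countable.

The claim is proved in two stages. The first passes from "small with high probability" to "small
almost everywhere" by subtracting a coboundary. Smallness is measured by an invariant subadditive
`ρ` (`InvariantSize`), and the induction is on the number `r` of initial entries on which one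
conditions: `SmallAt r` bounds the conditional probability of the bad set given almost every value
of those entries. To pass from `r` to `r + 1`, insert a point `ζ(g₁, …, gᵣ₊₁)` after the first `r +
1` entries. As `df = 0`, the resulting `cone` `ψ` expresses `f - dψ` through the first `r + 2` terms
of the bar formula alone (`sub_barDiff_cone`). Those faces turn `r + 1` initial entries into `r`, so
smallness given `r` entries becomes smallness given `r + 1`. The point `ζ` is chosen measurably so
that the exceptional sets are hit at most three times as often as on average
(`exists_insertion_point`). Once all entries but one are fixed, the cocycle identity with one
auxiliary variable gives the almost-everywhere bound (`InvariantSize.ae_le_of_smallAt`).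

In the second stage the almost-everywhere small cocycle is shown to be a coboundary. For discrete
`A`, take `ρ` to be the indicator of the nonzero elements: small then means zero. For a torus, take
`ρ` to be the largest norm on an orbit. A small cocycle lifts to a bounded `ℝⁿ`-valued function
satisfying the lifted cocycle identity, and averaging over the last variable yields a primitive. -/

namespace MeasurableCohomology

/-! ### Measurable selection from sets with large sections -/

section Selection

variable {X Y : Type*} [MeasurableSpace X] [MeasurableSpace Y]

theorem meas_lt_mul_lintegral_le (μ : Measure X) [IsProbabilityMeasure μ] {f : X → ℝ≥0∞}
    (hf : Measurable f) (hfin : ∫⁻ x, f x ∂μ ≠ ∞) :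
    μ {x | 3 * ∫⁻ y, f y ∂μ < f x} ≤ 3⁻¹ := by
  by_cases h0 : ∫⁻ x, f x ∂μ = 0
  · have h1 := (lintegral_eq_zero_iff hf).1 h0
    have : μ {x | 3 * ∫⁻ y, f y ∂μ < f x} = 0 := by
      rw [h0]
      have hsub : {x | 3 * 0 < f x} ⊆ {x | ¬ f x = (0 : X → ℝ≥0∞) x} := fun x hx hx' => by
        have hx'' : 3 * 0 < f x := hx
        simp [hx'] at hx''
      exact measure_mono_null hsub (ae_iff.1 h1)
    rw [this]; exact zero_le
  · have h1 := mul_meas_ge_le_lintegral (μ := μ) hf (3 * ∫⁻ x, f x ∂μ)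
    have h2 : μ {x | 3 * ∫⁻ y, f y ∂μ < f x} ≤ μ {x | 3 * ∫⁻ y, f y ∂μ ≤ f x} :=
      
      measure_mono fun x hx => le_of_lt (α := ℝ≥0∞) hx
    refine h2.trans ?_
    set I := ∫⁻ x, f x ∂μ
    rw [mul_comm 3 I, mul_assoc] at h1
    rw [ENNReal.le_inv_iff_mul_le, mul_comm]
    have h3 : I * (3 * μ {x | I * 3 ≤ f x}) ≤ I * 1 := by simpa using h1
    have h4 := (ENNReal.mul_le_mul_iff_right h0 hfin).1 h3
    simpa [mul_comm I 3] using h4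

/-- If the sections of a measurable set have measure at least `1/3`, finitely many points meet
all but a `(2/3)^k`-fraction of them. -/
theorem exists_points_meeting_sections (μ : Measure X) [IsProbabilityMeasure μ] (ν : Measure Y)
    [IsProbabilityMeasure ν] {E : Set (X × Y)} (hE : MeasurableSet E)
    (h : ∀ᵐ x ∂μ, 3⁻¹ ≤ ν {y | (x, y) ∈ E}) (k : ℕ) :
    ∃ z : Fin k → Y, μ {x | ∀ i, (x, z i) ∉ E} ≤ (1 - 3⁻¹) ^ k := by
  induction k with
  | zero => exact ⟨Fin.elim0, by simp⟩
  | succ k ih =>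
    obtain ⟨z, hz⟩ := ih
    set R : Set X := {x | ∀ i, (x, z i) ∉ E} with hR
    have hsec : ∀ y, MeasurableSet {x | (x, y) ∈ E} := fun y => measurable_prodMk_right hE
    have hRm : MeasurableSet R := by
      rw [hR, Set.ofPred_forall]
      exact MeasurableSet.iInter fun i => (hsec (z i)).compl
    have hcompl : ∀ᵐ x ∂μ.restrict R, ν {y | (x, y) ∈ Eᶜ} ≤ 1 - 3⁻¹ := by
      refine ae_restrict_of_ae ?_
      filter_upwards [h] with x hx
      exact (prob_compl_eq_one_sub (measurable_prodMk_left hE)).trans_le (tsub_le_tsub_left hx _)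
    have h1 : ∫⁻ y, μ.restrict R {x | (x, y) ∈ Eᶜ} ∂ν ≤ (1 - 3⁻¹) * μ R := by
      have e1 := Measure.prod_apply (μ := μ.restrict R) (ν := ν) hE.compl
      have e2 := Measure.prod_apply_symm (μ := μ.restrict R) (ν := ν) hE.compl
      have e3 : ∫⁻ y, μ.restrict R {x | (x, y) ∈ Eᶜ} ∂ν
          = ∫⁻ x, ν {y | (x, y) ∈ Eᶜ} ∂μ.restrict R := e2.symm.trans e1
      rw [e3]
      refine (lintegral_mono_ae hcompl).trans ?_
      simp
    -- By Fubini over `R × Y`, a random `y` misses on average at most two thirds of `R`; some `y`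
    -- does no worse than the average.
    obtain ⟨y, hy⟩ := exists_le_lintegral (μ := ν)
      (f := fun y => μ.restrict R {x | (x, y) ∈ Eᶜ})
      (measurable_measure_prodMk_right hE.compl).aemeasurable
    refine ⟨Fin.snoc z y, ?_⟩
    have h2 : {x | ∀ i, (x, (Fin.snoc z y : Fin (k + 1) → Y) i) ∉ E} = {x | (x, y) ∈ Eᶜ} ∩ R := by
      ext x
      simp [Fin.forall_fin_succ', hR, and_comm]
    rw [h2]
    calc μ ({x | (x, y) ∈ Eᶜ} ∩ R) = μ.restrict R {x | (x, y) ∈ Eᶜ} :=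
          (Measure.restrict_apply (hsec y).compl).symm
      _ ≤ (1 - 3⁻¹) * μ R := hy.trans h1
      _ ≤ (1 - 3⁻¹) * (1 - 3⁻¹) ^ k := by gcongr
      _ = _ := by rw [pow_succ']

/-- The finite families of test points together form one countable sequence that meets almost every
section, so `ζ` can take the first suitable term. No topology on `Y` is needed. -/
theorem exists_measurable_selection (μ : Measure X) [IsProbabilityMeasure μ] (ν : Measure Y)
    [IsProbabilityMeasure ν] {E : Set (X × Y)} (hE : MeasurableSet E)
    (h : ∀ᵐ x ∂μ, 3⁻¹ ≤ ν {y | (x, y) ∈ E}) :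
    ∃ ζ : X → Y, Measurable ζ ∧ ∀ᵐ x ∂μ, (x, ζ x) ∈ E := by
  classical
  choose z hz using exists_points_meeting_sections μ ν hE h
  have hY : Nonempty Y := ν.nonempty_of_neZero
  let w : ℕ → Y := fun n => match (Encodable.decode n : Option (Σ k, Fin k)) with
    | some s => z s.1 s.2
    | none => hY.some
  have hw : ∀ k i, ∃ n, w n = z k i := fun k i =>
    ⟨Encodable.encode (⟨k, i⟩ : Σ k, Fin k), by simp only [w, Encodable.encodek]⟩
  have hsec : ∀ y, MeasurableSet {x | (x, y) ∈ E} := fun y => measurable_prodMk_right hE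
  have hae : ∀ᵐ x ∂μ, ∃ n, (x, w n) ∈ E := by
    rw [ae_iff]
    refine le_antisymm (ge_of_tendsto' (ENNReal.tendsto_pow_atTop_nhds_zero_of_lt_one
      (r := 1 - 3⁻¹) (ENNReal.sub_lt_self (by simp) (by simp) (by simp)))
      fun k => (measure_mono ?_).trans (hz k)) zero_le
    intro x hx i hi
    obtain ⟨n, hn⟩ := hw k i
    exact hx ⟨n, hn ▸ hi⟩
  let E' : Set X := {x | ∃ n, (x, w n) ∈ E}
  have hE' : MeasurableSet E' := by
    change MeasurableSet {x | ∃ n, (x, w n) ∈ E}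
    rw [Set.ofPred_exists]
    exact MeasurableSet.iUnion fun n => hsec _
  -- On the null set where no term works, the first alternative stops the search at `0`, so that
  -- `Nat.find` is defined everywhere.
  have hP : ∀ x, ∃ n, x ∈ E'ᶜ ∨ (x, w n) ∈ E := fun x => by
    by_cases hx : x ∈ E'
    · obtain ⟨n, hn⟩ := hx
      exact ⟨n, Or.inr hn⟩
    · exact ⟨0, Or.inl hx⟩
  refine ⟨fun x => w (Nat.find (hP x)),
    (measurable_from_top (f := w)).comp (measurable_find hP fun n => hE'.compl.union (hsec (w n))),
    ?_⟩
  filter_upwards [hae] with x hx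
  exact (Nat.find_spec (hP x)).resolve_left (fun h => h hx)

end Selection

/-! ### Invariance of Haar measure, and the combinatorics of inserting a point -/

section Haar

/-- Lifting translations makes the push-forward a left-invariant probability measure, and uniqueness
of Haar measure identifies it. -/
theorem measurePreserving_of_mul_lift {K L : Type*} [Group K] [TopologicalSpace K]
    [IsTopologicalGroup K] [MeasurableSpace K] [BorelSpace K]
    [Group L] [TopologicalSpace L] [IsTopologicalGroup L] [CompactSpace L]
    [SecondCountableTopology L] [MeasurableSpace L] [BorelSpace L]
    (μ : Measure K) [IsProbabilityMeasure μ] [μ.IsMulLeftInvariant]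
    (ν : Measure L) [IsProbabilityMeasure ν] [ν.IsHaarMeasure] (F : K → L)
    (hF : Measurable F) (h : ∀ x : L, ∃ y : K, ∀ g, F (y * g) = x * F g) :
    MeasurePreserving F μ ν := by
  refine ⟨hF, ?_⟩
  have : IsProbabilityMeasure (μ.map F) :=
    Measure.isProbabilityMeasure_map hF.aemeasurable
  have hinv : (μ.map F).IsMulLeftInvariant := by
    refine ⟨fun x => ?_⟩
    obtain ⟨y, hy⟩ := h x
    rw [Measure.map_map (measurable_const_mul x) hF]
    have : (fun z => x * z) ∘ F = F ∘ fun g => y * g := by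
      funext g; exact (hy g).symm
    rw [this, ← Measure.map_map hF (measurable_const_mul y), map_mul_left_eq_self]
  have : (μ.map F).IsHaarMeasure :=
    Measure.isHaarMeasure_of_isCompact_nonempty_interior _ Set.univ isCompact_univ (by simp)
      (by simp) (by simp)
  exact Measure.isHaarMeasure_eq_of_isProbabilityMeasure _ _

variable {G : Type*}

/-- Replace the first `r` entries of `h` by `u`. -/
def splice {r n : ℕ} (u : Fin r → G) (h : Fin n → G) : Fin n → G :=
  fun i => if hi : (i : ℕ) < r then u ⟨i, hi⟩ else h i

/-- The first `r` entries. -/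
def initial {r n : ℕ} (hr : r ≤ n) (g : Fin n → G) : Fin r → G :=
  fun i => g (Fin.castLE hr i)

theorem initial_splice {r n : ℕ} (hr : r ≤ n) (u : Fin r → G) (h : Fin n → G) :
    initial hr (splice u h) = u := by
  funext i
  simp [initial, splice]

theorem tail_splice {k n : ℕ} (u : Fin (k + 1) → G) (h : Fin (n + 1) → G) :
    (fun i : Fin n => splice u h i.succ) =
      splice (fun i : Fin k => u i.succ) fun i => h i.succ := by
  funext i
  simp [splice]

variable [Group G]

/-- In terms of the partial products `1, g₁, g₁g₂, …` this inserts a point after the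
`r`-th one. -/
def insertAt {r n : ℕ} (hr : r ≤ n) (z : G) (g : Fin n → G) : Fin (n + 1) → G :=
  fun i => if h : (i : ℕ) < r then g ⟨i, by omega⟩ else
    if h' : (i : ℕ) = r then z else
      (if (i : ℕ) = r + 1 then z⁻¹ else 1) * g ⟨i - 1, by omega⟩

theorem splice_insertAt {r n : ℕ} (hr : r ≤ n) (u : Fin r → G) (z : G) (h : Fin n → G) :
    splice u (insertAt hr z h) = insertAt hr z (splice u h) := by
  funext i
  by_cases h1 : (i : ℕ) < r
  · simp [splice, insertAt, h1]
  · by_cases h2 : (i : ℕ) = r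
    · simp [splice, insertAt, h2]
    · have h3 : ¬ ((i : ℕ) - 1 < r) := by omega
      simp [splice, insertAt, h1, h2, h3]

/-- The inserted `z` cancels against the `z⁻¹` in the next entry; if `r = n` it is the last entry
and is simply dropped. -/
theorem contractNth_insertAt_self {r n : ℕ} (hr : r ≤ n) (z : G) (g : Fin n → G) :
    Fin.contractNth ⟨r, by omega⟩ (· * ·) (insertAt hr z g) = g := by
  funext i
  rcases lt_trichotomy (i : ℕ) r with h | h | h
  · rw [Fin.contractNth_apply_of_lt _ _ _ _ h]
    simp [insertAt, h]
  · rw [Fin.contractNth_apply_of_eq _ _ _ _ h]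
    simp [insertAt, h]
    congr 1
    exact Fin.ext h.symm
  · rw [Fin.contractNth_apply_of_gt _ _ _ _ h]
    have h1 : ¬ ((i : ℕ) + 1 < r) := by omega
    have h2 : ¬ ((i : ℕ) + 1 = r) := by omega
    have h3 : ¬ ((i : ℕ) = r) := by omega
    simp [insertAt, h1, h2, h3]

theorem contractNth_insertAt {r n : ℕ} (hr : r ≤ n) (hr' : r ≤ n + 1) (z : G)
    (g : Fin (n + 1) → G) (j : Fin (n + 1)) (hj : r ≤ j) :
    Fin.contractNth j.succ (· * ·) (insertAt hr' z g) =
      insertAt hr z (Fin.contractNth j (· * ·) g) := by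
  funext i
  rcases lt_trichotomy (i : ℕ) r with h | h | h
  · have h1 : (i : ℕ) < j := by omega
    have h2 : (i : ℕ) < j + 1 := by omega
    simp [insertAt, Fin.contractNth, h, h1, h2]
  · have h2 : (i : ℕ) < j + 1 := by omega
    simp [insertAt, Fin.contractNth, h]
    omega
  · have h1 : ¬ ((i : ℕ) < r) := by omega
    have h2 : ¬ ((i : ℕ) = r) := by omega
    have h3 : ¬ ((i : ℕ) + 1 < r) := by omega
    have h4 : ¬ ((i : ℕ) + 1 = r) := by omega
    rcases lt_trichotomy (i : ℕ) (j + 1) with h' | h' | h'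
    · have h5 : (i : ℕ) - 1 < j := by omega
      simp [insertAt, Fin.contractNth, h1, h2, h', h5]
    · have hlt : (j : ℕ) + 1 < n + 1 := h' ▸ i.2
      obtain rfl : i = ⟨j + 1, hlt⟩ := Fin.ext h'
      have h7 : ¬ ((j : ℕ) + 1 < r) := by omega
      have h8 : ¬ ((j : ℕ) + 1 = r) := by omega
      have h9 : ¬ ((j : ℕ) + 1 + 1 < r) := by omega
      have h10 : ¬ ((j : ℕ) + 1 + 1 = r) := by omega
      simp [insertAt, Fin.contractNth, h7, h8, h9, h10, mul_assoc]
    · have h5 : ¬ ((i : ℕ) - 1 < j) := by omega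
      have h6 : ¬ ((i : ℕ) - 1 = j) := by omega
      have h7 : ¬ ((i : ℕ) < j + 1) := by omega
      have h8 : ¬ ((i : ℕ) = j + 1) := by omega
      have h10 : ¬ ((i : ℕ) = r + 1) := by omega
      have h11 : (i : ℕ) - 1 + 1 = i := by omega
      simp [insertAt, Fin.contractNth, h1, h2, h3, h4, h5, h6, h7, h8, h10, h11]

theorem initial_contractNth {r n : ℕ} (hr : r ≤ n) (hr' : r ≤ n + 1) (g : Fin (n + 1) → G)
    (j : Fin (n + 1)) (hj : r ≤ j) :
    initial hr (Fin.contractNth j (· * ·) g) = initial hr' g := by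
  funext i
  have : (i : ℕ) < j := by omega
  simp [initial, Fin.contractNth, this]

/-- A contraction among the fixed entries leaves the free ones alone, except that `j = k` multiplies
the first free entry by the last fixed one. Given `u` this is a translation, so it does not affect
Haar measure. -/
theorem contractNth_splice {k n : ℕ} (hk : k ≤ n) (u : Fin (k + 1) → G) (h : Fin (n + 1) → G)
    (j : Fin (k + 1)) :
    Fin.contractNth (Fin.castLE (by omega) j) (· * ·) (splice u h) =
      splice (Fin.contractNth j (· * ·) u)
        ((fun i : Fin n => if (i : ℕ) = j then u (Fin.last k) else 1) * fun i => h i.succ) := by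
  funext i
  have hj := j.2
  by_cases hik : (i : ℕ) < k
  · have h1 : (i : ℕ) < k + 1 := by omega
    simp [splice, Fin.contractNth, hik, h1]
  · have h1 : ¬ ((i : ℕ) < j) := by omega
    by_cases h2 : (i : ℕ) = j
    · have h3 : (j : ℕ) = k := by omega
      simp [splice, Fin.contractNth, h2, h3]
      rfl
    · simp [splice, Fin.contractNth, hik, h1, h2]

end Haar

/-! ### Conditional smallness given the first entries -/

section Small

variable {G : Type*} [Group G] [TopologicalSpace G] [IsTopologicalGroup G] [CompactSpace G]
  [T2Space G] [SecondCountableTopology G] [MeasurableSpace G] [BorelSpace G]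

theorem measurable_splice {r n : ℕ} :
    Measurable fun x : (Fin r → G) × (Fin n → G) => splice x.1 x.2 := by
  refine measurable_pi_lambda _ fun i => ?_
  unfold splice
  split_ifs <;> fun_prop

theorem measurable_initial {r n : ℕ} (hr : r ≤ n) :
    Measurable (initial hr : (Fin n → G) → Fin r → G) :=
  measurable_pi_lambda _ fun _ => measurable_pi_apply _

theorem measurable_insertAt {r n : ℕ} (hr : r ≤ n) :
    Measurable fun x : G × (Fin n → G) => insertAt hr x.1 x.2 := by
  refine measurable_pi_lambda _ fun i => ?_
  unfold insertAt
  split_ifs <;> fun_prop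

theorem measurable_contractNth {n : ℕ} (j : Fin (n + 1)) :
    Measurable fun g : Fin (n + 1) → G => Fin.contractNth j (· * ·) g :=
  (measurePreserving_contractNth n j).measurable

theorem measurable_tail {n : ℕ} :
    Measurable fun (g : Fin (n + 1) → G) (i : Fin n) => g i.succ :=
  (measurePreserving_tail n).measurable

theorem measurePreserving_splice (r n : ℕ) :
    MeasurePreserving (fun x : (Fin r → G) × (Fin n → G) => splice x.1 x.2)
      ((haarPow G r).prod (haarPow G n)) (haarPow G n) := by
  refine measurePreserving_of_mul_lift _ _ _ measurable_splice fun x =>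
    ⟨(fun i => if h : (i : ℕ) < n then x ⟨i, h⟩ else 1, x), fun g => ?_⟩
  funext i
  by_cases hi : (i : ℕ) < r <;> simp [splice, hi]

theorem measurePreserving_update {n : ℕ} (k : Fin n) :
    MeasurePreserving (fun x : G × (Fin n → G) => Function.update x.2 k x.1)
      ((haarProb G).prod (haarPow G n)) (haarPow G n) := by
  refine measurePreserving_of_mul_lift _ _ _ ?_ fun x => ⟨(x k, x), fun g => ?_⟩
  · refine measurable_pi_lambda _ fun i => ?_
    by_cases hi : i = k
    · subst hi; simpa using measurable_fst
    · simp only [Function.update_of_ne hi]; fun_prop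
  · funext i
    by_cases hi : i = k
    · subst hi; simp
    · simp [Function.update_of_ne hi]

theorem measurePreserving_insertAt {r n : ℕ} (hr : r ≤ n) :
    MeasurePreserving (fun x : G × (Fin n → G) => insertAt hr x.1 x.2)
      ((haarProb G).prod (haarPow G n)) (haarPow G (n + 1)) := by
  let a : G → Fin n → G := fun z i => if (i : ℕ) = r then z⁻¹ else 1
  have ha : Measurable a := by
    refine measurable_pi_lambda _ fun i => ?_
    by_cases hi : (i : ℕ) = r <;> simp only [a, hi, if_true, if_false] <;> fun_prop
  -- Insertion is a reordering of coordinates `F` preceded by the shear that multiplies entry `r`,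
  -- if there is one, by `z⁻¹`.
  have h1 : MeasurePreserving (fun x : G × (Fin n → G) => (x.1, a x.1 * x.2))
      ((haarProb G).prod (haarPow G n)) ((haarProb G).prod (haarPow G n)) :=
    (MeasurePreserving.id (haarProb G)).skew_product (g := fun z h => a z * h)
      ((ha.comp measurable_fst).mul measurable_snd)
      (Filter.Eventually.of_forall fun z => map_mul_left_eq_self _ _)
  let F : G × (Fin n → G) → Fin (n + 1) → G := fun x i =>
    if h : (i : ℕ) < r then x.2 ⟨i, by omega⟩ else
    if h' : (i : ℕ) = r then x.1 else x.2 ⟨i - 1, by omega⟩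
  have h2 : MeasurePreserving F ((haarProb G).prod (haarPow G n)) (haarPow G (n + 1)) := by
    refine measurePreserving_of_mul_lift _ _ _ ?_ fun x =>
      ⟨(x ⟨r, by omega⟩, fun i => if (i : ℕ) < r then x i.castSucc else x i.succ), fun g => ?_⟩
    · refine measurable_pi_lambda _ fun i => ?_
      simp only [F]
      split_ifs <;> fun_prop
    · funext i
      simp only [F]
      by_cases h1 : (i : ℕ) < r
      · simp [h1]
      · by_cases h2 : (i : ℕ) = r
        · have : x ⟨r, by omega⟩ = x i := congrArg x (Fin.ext h2.symm)
          simp [h2, this]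
        · have h3 : ¬ ((i : ℕ) - 1 < r) := by omega
          have h4 : (i : ℕ) - 1 + 1 = i := by omega
          simp [h1, h2, h3, h4]
  convert h2.comp h1 using 1
  funext x i
  simp only [insertAt, F, a, Function.comp_apply]
  by_cases h1 : (i : ℕ) < r
  · have h2 : ¬ ((i : ℕ) = r) := by omega
    simp [h1, h2]
  · by_cases h2 : (i : ℕ) = r
    · simp [h2]
    · have h3 : (i : ℕ) - 1 = r ↔ (i : ℕ) = r + 1 := by omega
      simp [h1, h2, h3]

/-- For almost every choice of the first `r` entries, the set `N` has conditional probability at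
most `ε`. -/
def SmallAt (r : ℕ) (ε : ℝ≥0∞) {n : ℕ} (N : Set (Fin n → G)) : Prop :=
  ∀ᵐ u ∂haarPow G r, haarPow G n {h | splice u h ∈ N} ≤ ε

theorem SmallAt.mono {r n : ℕ} {ε ε' : ℝ≥0∞} {N N' : Set (Fin n → G)} (h : SmallAt r ε N)
    (hN : N' ⊆ N) (hε : ε ≤ ε') : SmallAt r ε' N' := by
  filter_upwards [h] with u hu
  have hs : {h | splice u h ∈ N'} ⊆ {h | splice u h ∈ N} := fun x hx => hN hx
  exact (measure_mono hs).trans (hu.trans hε)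

theorem SmallAt.union {r n : ℕ} {ε ε' : ℝ≥0∞} {N N' : Set (Fin n → G)} (h : SmallAt r ε N)
    (h' : SmallAt r ε' N') : SmallAt r (ε + ε') (N ∪ N') := by
  filter_upwards [h, h'] with u hu hu'
  exact (measure_union_le _ _).trans (add_le_add hu hu')

theorem smallAt_of_null (r : ℕ) {n : ℕ} {N : Set (Fin n → G)} (h : haarPow G n N = 0) :
    SmallAt r 0 N := by
  have h1 : ∀ᵐ x ∂(haarPow G r).prod (haarPow G n), splice x.1 x.2 ∉ N :=
    (measurePreserving_splice r n).quasiMeasurePreserving.ae (measure_eq_zero_iff_ae_notMem.1 h)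
  filter_upwards [Measure.ae_ae_of_ae_prod h1] with u hu
  exact (measure_eq_zero_iff_ae_notMem.2 hu).le

theorem smallAt_zero {n : ℕ} {ε : ℝ≥0∞} {N : Set (Fin n → G)} (h : haarPow G n N ≤ ε) :
    SmallAt 0 ε N := by
  refine Filter.Eventually.of_forall fun u => ?_
  have : {h | splice u h ∈ N} = N := by
    ext h
    have : splice u h = h := by funext i; simp [splice]
    simp [this]
  rwa [this]

/-- The tuples having one of their first `r + 2` faces in `N`. -/
def headFaces (r : ℕ) {n : ℕ} (N : Set (Fin n → G)) : Set (Fin (n + 1) → G) :=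
  {g | (fun i : Fin n => g i.succ) ∈ N ∨
    ∃ j : Fin (n + 1), (j : ℕ) ≤ r ∧ Fin.contractNth j (· * ·) g ∈ N}

theorem measurableSet_headFaces (r : ℕ) {n : ℕ} {N : Set (Fin n → G)} (hN : MeasurableSet N) :
    MeasurableSet (headFaces r N) := by
  have : headFaces r N = (fun (g : Fin (n + 1) → G) (i : Fin n) => g i.succ) ⁻¹' N ∪
      ⋃ j : Fin (n + 1), ⋃ _ : (j : ℕ) ≤ r,
        (fun g : Fin (n + 1) → G => Fin.contractNth j (· * ·) g) ⁻¹' N := by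
    ext g; simp [headFaces]
  rw [this]
  exact (measurable_tail hN).union
    (MeasurableSet.iUnion fun j => MeasurableSet.iUnion fun _ => measurable_contractNth j hN)

/-- Each of the `r + 2` faces sends the first `r + 1` entries to `r` entries by a measure-preserving
map, and the free entries to a translate of their tail. The union bound gives the factor `r + 2`. -/
theorem SmallAt.headFaces {r n : ℕ} (hr : r ≤ n) {ε : ℝ≥0∞} {N : Set (Fin n → G)}
    (hN : MeasurableSet N) (h : SmallAt r ε N) :
    SmallAt (r + 1) ((r + 2 : ℕ) * ε) (headFaces r N) := by
  have h0 := (measurePreserving_tail (G := G) r).quasiMeasurePreserving.ae h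
  have hj := ae_all_iff.2 fun j : Fin (r + 1) =>
    (measurePreserving_contractNth (G := G) r j).quasiMeasurePreserving.ae h
  filter_upwards [h0, hj] with u hu0 huj
  have hm : ∀ v : Fin r → G, MeasurableSet {h | splice v h ∈ N} := fun v =>
    (measurable_splice.comp (measurable_const.prodMk measurable_id)) hN
  have hsub : {h | splice u h ∈ MeasurableCohomology.headFaces r N} ⊆
      (fun (g : Fin (n + 1) → G) (i : Fin n) => g i.succ) ⁻¹'
        {h | splice (fun i : Fin r => u i.succ) h ∈ N} ∪
      ⋃ j : Fin (r + 1), (fun (g : Fin (n + 1) → G) (i : Fin n) => g i.succ) ⁻¹'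
        ((fun h => (fun i : Fin n => if (i : ℕ) = j then u (Fin.last r) else 1) * h) ⁻¹'
          {h | splice (Fin.contractNth j (· * ·) u) h ∈ N}) := by
    rintro h (hh | ⟨j, hj, hh⟩)
    · left
      rwa [tail_splice] at hh
    · right
      refine Set.mem_iUnion.2 ⟨⟨j, by omega⟩, ?_⟩
      have := contractNth_splice hr u h ⟨j, by omega⟩
      rw [show j = Fin.castLE (by omega) (⟨j, by omega⟩ : Fin (r + 1)) from rfl, this] at hh
      exact hh
  refine (measure_mono hsub).trans ((measure_union_le _ _).trans ?_)
  have e0 := (measurePreserving_tail (G := G) n).measure_preimage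
    (hm (fun i : Fin r => u i.succ)).nullMeasurableSet
  rw [e0]
  refine (add_le_add hu0 (measure_iUnion_le _)).trans ?_
  have ej : ∀ j : Fin (r + 1), haarPow G (n + 1)
      ((fun (g : Fin (n + 1) → G) (i : Fin n) => g i.succ) ⁻¹'
        ((fun h => (fun i : Fin n => if (i : ℕ) = j then u (Fin.last r) else 1) * h) ⁻¹'
          {h | splice (Fin.contractNth j (· * ·) u) h ∈ N})) ≤ ε := fun j => by
    rw [(measurePreserving_tail (G := G) n).measure_preimage
      ((measurable_const_mul _) (hm _)).nullMeasurableSet, measure_preimage_mul]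
    exact huj j
  rw [tsum_fintype]
  refine (add_le_add_right (Finset.sum_le_sum fun j _ => ej j) ε).trans ?_
  simp only [Finset.sum_const, Finset.card_univ, Fintype.card_fin, nsmul_eq_mul]
  refine le_of_eq ?_
  push_cast
  ring

end Small

/-! ### The cone identity and invariant sizes -/

section Algebra

variable {G A : Type*} [Group G] [AddCommGroup A] [DistribMulAction G A]

/-- The first `r + 2` terms of the bar differential. -/
def headSum (r : ℕ) {n : ℕ} (f : (Fin n → G) → A) (g : Fin (n + 1) → G) : A :=
  g 0 • f (fun i => g i.succ) +
    ∑ j : Fin (n + 1), if (j : ℕ) ≤ r then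
      (-1 : ℤ) ^ ((j : ℕ) + 1) • f (Fin.contractNth j (· * ·) g) else 0

/-- The terms of the bar differential after the first `r + 2` ones. -/
def tailSum (r : ℕ) {n : ℕ} (f : (Fin n → G) → A) (g : Fin (n + 1) → G) : A :=
  ∑ j : Fin (n + 1), if (j : ℕ) ≤ r then 0 else
      (-1 : ℤ) ^ ((j : ℕ) + 1) • f (Fin.contractNth j (· * ·) g)

theorem headSum_add_tailSum (r : ℕ) {n : ℕ} (f : (Fin n → G) → A) (g : Fin (n + 1) → G) :
    headSum r f g + tailSum r f g = barDiff f g := by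
  rw [headSum, tailSum, barDiff, add_assoc, ← Finset.sum_add_distrib]
  congr 1
  refine Finset.sum_congr rfl fun j _ => ?_
  split_ifs <;> simp

/-- The cochain obtained by inserting the point `ζ (g₁, …, gᵣ)` into the argument of `f`. -/
def cone {r n : ℕ} (hr : r ≤ n) (ζ : (Fin r → G) → G) (f : (Fin (n + 1) → G) → A)
    (g : Fin n → G) : A :=
  (-1 : ℤ) ^ (r + 1) • f (insertAt hr (ζ (initial hr g)) g)

/-- The first remaining face removes the inserted point and returns `f g`. The later ones commute
with insertion and do not touch the entries on which `ζ` depends, so they assemble into the tail of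
the cone, with a shift of sign. -/
theorem tailSum_insertAt {r n : ℕ} (hr : r + 1 ≤ n) (ζ : (Fin (r + 1) → G) → G)
    (f : (Fin (n + 1) → G) → A) (g : Fin (n + 1) → G) :
    tailSum r f (insertAt (by omega : r + 1 ≤ n + 1) (ζ (initial (by omega) g)) g) =
      (-1 : ℤ) ^ r • (f g - tailSum r (cone hr ζ f) g) := by
  rw [tailSum, Fin.sum_univ_succ]
  simp only [Fin.val_zero, zero_le, if_true, zero_add, Fin.val_succ]
  rw [smul_sub, tailSum, Finset.smul_sum]
  have hj : ∀ j : Fin (n + 1), (if (j : ℕ) + 1 ≤ r then (0 : A) else (-1 : ℤ) ^ ((j : ℕ) + 1 + 1) •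
      f (Fin.contractNth j.succ (· * ·)
        (insertAt (by omega : r + 1 ≤ n + 1) (ζ (initial (by omega) g)) g))) =
      (if j = ⟨r, by omega⟩ then (-1 : ℤ) ^ r • f g else 0) -
      (-1 : ℤ) ^ r • if (j : ℕ) ≤ r then 0 else
        (-1 : ℤ) ^ ((j : ℕ) + 1) • cone hr ζ f (Fin.contractNth j (· * ·) g) := fun j => by
    rcases lt_trichotomy (j : ℕ) r with h | h | h
    · have h1 : ¬ j = ⟨r, by omega⟩ := fun h' => by simp [h'] at h
      simp [h1, h.le, Nat.succ_le_of_lt h]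
    · have hlt : r < n + 1 := by omega
      obtain rfl : j = ⟨r, hlt⟩ := Fin.ext h
      have h1 : ¬ (r + 1 ≤ r) := by omega
      have h2 : Fin.succ (⟨r, by omega⟩ : Fin (n + 1)) = ⟨r + 1, by omega⟩ := rfl
      simp only [h1, if_false, le_refl, if_true, smul_zero, sub_zero, h2,
        contractNth_insertAt_self]
      rw [pow_add, pow_add]
      simp
    · have h1 : ¬ ((j : ℕ) + 1 ≤ r) := by omega
      have h2 : ¬ ((j : ℕ) ≤ r) := by omega
      have h3 : ¬ j = ⟨r, by omega⟩ := fun h' => by simp [h'] at h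
      have h4 : r + 1 ≤ (j : ℕ) := h
      simp only [h1, h2, h3, if_false, zero_sub, cone]
      rw [contractNth_insertAt hr (by omega) _ _ _ h4, initial_contractNth hr (by omega) _ _ h4,
        smul_smul, smul_smul, ← neg_smul]
      congr 1
      have h5 : ((-1 : ℤ) ^ r) * (-1) ^ r = 1 := by rw [← mul_pow]; simp
      linear_combination (-(-1 : ℤ) ^ (j : ℕ)) * h5
  rw [Finset.sum_congr rfl fun j _ => hj j, Finset.sum_sub_distrib]
  simp

/-- For a cocycle the `barDiff f` term vanishes, and what remains is two head sums, whose faces are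
controlled conditionally. -/
theorem sub_barDiff_cone {r n : ℕ} (hr : r + 1 ≤ n) (ζ : (Fin (r + 1) → G) → G)
    (f : (Fin (n + 1) → G) → A) (g : Fin (n + 1) → G) :
    f g - barDiff (cone hr ζ f) g = (-1 : ℤ) ^ r •
      (barDiff f (insertAt (by omega : r + 1 ≤ n + 1) (ζ (initial (by omega) g)) g) -
        headSum r f (insertAt (by omega : r + 1 ≤ n + 1) (ζ (initial (by omega) g)) g)) -
      headSum r (cone hr ζ f) g := by
  have hsq : ∀ a : A, (-1 : ℤ) ^ r • (-1 : ℤ) ^ r • a = a := fun a => by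
    rw [smul_smul, ← mul_pow]; simp
  rw [← headSum_add_tailSum r f, add_sub_cancel_left, tailSum_insertAt hr ζ f g, hsq,
    ← headSum_add_tailSum r]
  abel

/-- A subadditive, even and invariant function on the module `A`. -/
structure InvariantSize (G : Type*) [Group G] {A : Type*} [AddCommGroup A] [TopologicalSpace A]
    [DistribMulAction G A] (ρ : A → ℝ) : Prop where
  zero : ρ 0 = 0
  add_le : ∀ a b, ρ (a + b) ≤ ρ a + ρ b
  neg : ∀ a, ρ (-a) = ρ a
  smul : ∀ (g : G) a, ρ (g • a) = ρ a
  isClosed_le : ∀ δ, IsClosed {a | ρ a ≤ δ}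

namespace InvariantSize

variable [TopologicalSpace A] {ρ : A → ℝ} (h : InvariantSize G ρ)
include h

theorem sub_le (a b : A) : ρ (a - b) ≤ ρ a + ρ b := by
  rw [sub_eq_add_neg, ← h.neg b]
  exact h.add_le _ _

theorem neg_one_pow_smul (k : ℕ) (a : A) : ρ ((-1 : ℤ) ^ k • a) = ρ a := by
  rcases neg_one_pow_eq_or ℤ k with hk | hk <;> simp [hk, h.neg]

theorem sum_le {ι : Type*} (s : Finset ι) (a : ι → A) : ρ (∑ i ∈ s, a i) ≤ ∑ i ∈ s, ρ (a i) :=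
  Finset.le_sum_of_subadditive ρ h.zero.le h.add_le s a

theorem headSum_le {r n : ℕ} (hr : r ≤ n) {f : (Fin n → G) → A} {δ : ℝ} {g : Fin (n + 1) → G}
    (hg : g ∉ headFaces r {g | δ < ρ (f g)}) : ρ (headSum r f g) ≤ (r + 2) * δ := by
  have h1 : ρ (f fun i => g i.succ) ≤ δ := not_lt.1 fun hlt => hg (Or.inl hlt)
  have h2 : ∀ j : Fin (n + 1), (j : ℕ) ≤ r → ρ (f (Fin.contractNth j (· * ·) g)) ≤ δ :=
    fun j hj => not_lt.1 fun hlt => hg (Or.inr ⟨j, hj, hlt⟩)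
  refine (h.add_le _ _).trans ?_
  rw [h.smul, ← Finset.sum_filter]
  have h3 : ρ (∑ j ∈ Finset.univ.filter fun j : Fin (n + 1) => (j : ℕ) ≤ r,
      (-1 : ℤ) ^ ((j : ℕ) + 1) • f (Fin.contractNth j (· * ·) g)) ≤ (r + 1) * δ := by
    refine (h.sum_le _ _).trans ((Finset.sum_le_card_nsmul _ _ δ fun j hj => ?_).trans ?_)
    · rw [h.neg_one_pow_smul]
      exact h2 j (Finset.mem_filter.1 hj).2
    · have : (Finset.univ.filter fun j : Fin (n + 1) => (j : ℕ) ≤ r).card = r + 1 := by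
        have e : (Finset.univ.filter fun j : Fin (n + 1) => (j : ℕ) ≤ r) =
            Finset.univ.filter fun j : Fin (n + 1) => (j : ℕ) < r + 1 := by
          ext j; simp
        rw [e, Fin.card_filter_val_lt]
        omega
      rw [this]
      simp
  linarith

end InvariantSize

end Algebra

/-! ### Choosing the inserted point and improving the conditioning -/

section Reduction

variable {G : Type*} [Group G] [TopologicalSpace G] [IsTopologicalGroup G] [CompactSpace G]
  [T2Space G] [SecondCountableTopology G] [MeasurableSpace G] [BorelSpace G]

theorem measurableSet_insertAt {r n : ℕ} (hr : r ≤ n) {N : Set (Fin (n + 1) → G)}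
    (hN : MeasurableSet N) :
    MeasurableSet {x : ((Fin r → G) × G) × (Fin n → G) |
      insertAt hr x.1.2 (splice x.1.1 x.2) ∈ N} := by
  have h1 : Measurable fun x : ((Fin r → G) × G) × (Fin n → G) =>
      insertAt hr x.1.2 (splice x.1.1 x.2) :=
    (measurable_insertAt hr).comp ((measurable_snd.comp measurable_fst).prodMk
      (measurable_splice.comp ((measurable_fst.comp measurable_fst).prodMk measurable_snd)))
  exact h1 hN

/-- Insertion of a random point preserves Haar measure; this identifies the average to which
Markov's inequality is applied. -/
theorem lintegral_insertAt {r n : ℕ} (hr : r ≤ n) {N : Set (Fin (n + 1) → G)}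
    (hN : MeasurableSet N) (u : Fin r → G) :
    ∫⁻ z, haarPow G n {h | insertAt hr z (splice u h) ∈ N} ∂haarProb G =
      haarPow G (n + 1) {w | splice u w ∈ N} := by
  have hm : MeasurableSet {w : Fin (n + 1) → G | splice u w ∈ N} :=
    (measurable_splice.comp (measurable_const.prodMk measurable_id)) hN
  rw [← (measurePreserving_insertAt hr).measure_preimage hm.nullMeasurableSet,
    Measure.prod_apply ((measurable_insertAt hr) hm)]
  refine lintegral_congr fun z => ?_
  congr 1
  ext h
  simp [splice_insertAt]

/-- The inserted point can be chosen measurably so that two exceptional sets are met at most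
three times as often as on average. -/
theorem exists_insertion_point {r m n : ℕ} (hm : r ≤ m) (hn : r ≤ n)
    {N : Set (Fin (m + 1) → G)} (hN : MeasurableSet N)
    {M : Set (Fin (n + 1) → G)} (hM : MeasurableSet M) :
    ∃ ζ : (Fin r → G) → G, Measurable ζ ∧
      (∀ᵐ u ∂haarPow G r, haarPow G m {h | insertAt hm (ζ u) (splice u h) ∈ N} ≤
        3 * haarPow G (m + 1) {w | splice u w ∈ N}) ∧
      ∀ᵐ u ∂haarPow G r, haarPow G n {h | insertAt hn (ζ u) (splice u h) ∈ M} ≤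
        3 * haarPow G (n + 1) {w | splice u w ∈ M} := by
  have hb : ∀ {k : ℕ} {K : Set (Fin (k + 1) → G)} (_ : MeasurableSet K),
      Measurable fun x : (Fin r → G) × G =>
        3 * haarPow G (k + 1) {w | splice x.1 w ∈ K} := fun {k K} hK => by
    refine Measurable.const_mul ?_ _
    exact (measurable_measure_prodMk_left (ν := haarPow G (k + 1))
      (measurable_splice hK)).comp measurable_fst
  have ha : ∀ {k : ℕ} (hk : r ≤ k) {K : Set (Fin (k + 1) → G)} (_ : MeasurableSet K),
      Measurable fun x : (Fin r → G) × G =>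
        haarPow G k {h | insertAt hk x.2 (splice x.1 h) ∈ K} := fun {k} hk {K} hK =>
    measurable_measure_prodMk_left (ν := haarPow G k) (measurableSet_insertAt hk hK)
  have key : ∀ {k : ℕ} (hk : r ≤ k) {K : Set (Fin (k + 1) → G)} (_ : MeasurableSet K)
      (u : Fin r → G), haarProb G {z | 3 * haarPow G (k + 1) {w | splice u w ∈ K} <
        haarPow G k {h | insertAt hk z (splice u h) ∈ K}} ≤ 3⁻¹ := fun {k} hk {K} hK u => by
    have := meas_lt_mul_lintegral_le (haarProb G)
      (f := fun z => haarPow G k {h | insertAt hk z (splice u h) ∈ K})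
      ((ha hk hK).comp (measurable_const.prodMk measurable_id))
      (by rw [lintegral_insertAt hk hK]; exact measure_ne_top _ _)
    rwa [lintegral_insertAt hk hK] at this
  let E : Set ((Fin r → G) × G) :=
    {x | haarPow G m {h | insertAt hm x.2 (splice x.1 h) ∈ N} ≤
        3 * haarPow G (m + 1) {w | splice x.1 w ∈ N}} ∩
      {x | haarPow G n {h | insertAt hn x.2 (splice x.1 h) ∈ M} ≤
        3 * haarPow G (n + 1) {w | splice x.1 w ∈ M}}
  have hE : MeasurableSet E :=
    (measurableSet_le (ha hm hN) (hb hN)).inter (measurableSet_le (ha hn hM) (hb hM))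
  obtain ⟨ζ, hζ, h⟩ := exists_measurable_selection (haarPow G r) (haarProb G) hE
    (Filter.Eventually.of_forall fun u => by
      have hcov : (Set.univ : Set G) ⊆ {z | (u, z) ∈ E} ∪
          ({z | 3 * haarPow G (m + 1) {w | splice u w ∈ N} <
            haarPow G m {h | insertAt hm z (splice u h) ∈ N}} ∪
          -- By Markov each of the two bad sets of points has measure at most `1/3`, which leaves at
          -- least `1/3` for the good points.
          {z | 3 * haarPow G (n + 1) {w | splice u w ∈ M} <
            haarPow G n {h | insertAt hn z (splice u h) ∈ M}}) := fun z _ => by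
        by_contra hz
        simp only [Set.mem_union, not_or] at hz
        have hz1 : _ ≤ 3 * haarPow G (m + 1) {w | splice u w ∈ N} := not_lt.1 hz.2.1
        have hz2 : _ ≤ 3 * haarPow G (n + 1) {w | splice u w ∈ M} := not_lt.1 hz.2.2
        exact hz.1 ⟨hz1, hz2⟩
      have h1 := (measure_mono hcov).trans ((measure_union_le (μ := haarProb G) _ _).trans
        (add_le_add_right ((measure_union_le _ _).trans
          (add_le_add (key hm hN u) (key hn hM u))) _))
      rw [measure_univ] at h1
      have h3 : (3⁻¹ : ℝ≥0∞) + (3⁻¹ + 3⁻¹) = 1 := by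
        rw [← ENNReal.inv_three_add_inv_three, add_assoc]
      rw [← h3] at h1
      exact (ENNReal.add_le_add_iff_right (by simp)).1 h1)
  refine ⟨ζ, hζ, ?_, ?_⟩
  · filter_upwards [h] with u hu using hu.1
  · filter_upwards [h] with u hu using hu.2

theorem splice_snoc {r n : ℕ} (hr : r < n) (v : Fin r → G) (t : G) (h : Fin n → G) :
    splice (Fin.snoc (α := fun _ => G) v t : Fin (r + 1) → G) h =
      splice v (Function.update h ⟨r, hr⟩ t) := by
  funext i
  rcases lt_trichotomy (i : ℕ) r with hi | hi | hi
  · have h1 : (i : ℕ) < r + 1 := by omega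
    simp [splice, hi, h1, Fin.snoc]
  · have h1 : i = ⟨r, hr⟩ := Fin.ext hi
    subst h1
    simp [splice, Fin.snoc]
  · have h1 : ¬ (i : ℕ) < r + 1 := by omega
    have h2 : ¬ (i : ℕ) < r := by omega
    have h3 : i ≠ ⟨r, hr⟩ := fun h' => by simp [h'] at hi
    simp [splice, h1, h2, Function.update_of_ne h3]

theorem measurePreserving_snoc (r : ℕ) :
    MeasurePreserving (fun x : (Fin r → G) × G =>
      (Fin.snoc (α := fun _ => G) x.1 x.2 : Fin (r + 1) → G))
      ((haarPow G r).prod (haarProb G)) (haarPow G (r + 1)) := by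
  refine measurePreserving_of_mul_lift _ _ _ ?_ fun x =>
    ⟨(fun i => x i.castSucc, x (Fin.last r)), fun g => ?_⟩
  · refine measurable_pi_lambda _ fun i => ?_
    refine Fin.lastCases ?_ (fun i => ?_) i
    · simpa using measurable_snd
    · simp only [Fin.snoc_castSucc]; fun_prop
  · funext i
    refine Fin.lastCases ?_ (fun i => ?_) i <;> simp

theorem lintegral_splice_snoc {r n : ℕ} (hr : r < n) {N : Set (Fin n → G)}
    (hN : MeasurableSet N) (v : Fin r → G) :
    ∫⁻ t, haarPow G n {h | splice (Fin.snoc (α := fun _ => G) v t : Fin (r + 1) → G) h ∈ N}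
      ∂haarProb G = haarPow G n {h | splice v h ∈ N} := by
  have hm : MeasurableSet {w : Fin n → G | splice v w ∈ N} :=
    (measurable_splice.comp (measurable_const.prodMk measurable_id)) hN
  have hu := measurePreserving_update (G := G) ⟨r, hr⟩
  rw [← hu.measure_preimage hm.nullMeasurableSet, Measure.prod_apply (hu.measurable hm)]
  refine lintegral_congr fun t => ?_
  congr 1
  ext h
  simp [splice_snoc hr]

/-- `ζ` sees `r + 1` entries while `M` is controlled only given `r`; integrating the comparison over
the extra entry bridges the gap. -/
theorem SmallAt.insertAt {r n : ℕ} (hr : r + 1 ≤ n) {ε : ℝ≥0∞} {M : Set (Fin (n + 1) → G)}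
    (hM : MeasurableSet M) (h : SmallAt r ε M) {ζ : (Fin (r + 1) → G) → G} (hζ : Measurable ζ)
    (hζM : ∀ᵐ u ∂haarPow G (r + 1), haarPow G n
      {h | MeasurableCohomology.insertAt hr (ζ u) (splice u h) ∈ M} ≤
        3 * haarPow G (n + 1) {w | splice u w ∈ M}) :
    SmallAt r (3 * ε) {g | MeasurableCohomology.insertAt hr (ζ (initial hr g)) g ∈ M} := by
  have hK : MeasurableSet
      {g : Fin n → G | MeasurableCohomology.insertAt hr (ζ (initial hr g)) g ∈ M} :=
    ((measurable_insertAt hr).comp ((hζ.comp (measurable_initial hr)).prodMk measurable_id)) hM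
  have h1 := Measure.ae_ae_of_ae_prod
    ((measurePreserving_snoc (G := G) r).quasiMeasurePreserving.ae hζM)
  filter_upwards [h, h1] with v hv hv1
  refine (lintegral_splice_snoc (by omega) hK v).symm.le.trans ?_
  calc _ ≤ ∫⁻ t, 3 * haarPow G (n + 1)
        {w | splice (Fin.snoc (α := fun _ => G) v t : Fin (r + 1) → G) w ∈ M} ∂haarProb G := by
        refine lintegral_mono_ae ?_
        filter_upwards [hv1] with t ht
        simpa only [Set.mem_ofPred_eq, initial_splice] using ht
    _ = 3 * haarPow G (n + 1) {w | splice v w ∈ M} := by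
        rw [lintegral_const_mul' _ _ (by simp), lintegral_splice_snoc (by omega) hM]
    _ ≤ 3 * ε := by gcongr

variable {A : Type*} [AddCommGroup A] [TopologicalSpace A] [IsTopologicalAddGroup A]
  [PolishSpace A] [DistribMulAction G A] [ContinuousSMul G A]

theorem stronglyMeasurable_barDiff {n : ℕ} {f : (Fin n → G) → A} (hf : StronglyMeasurable f) :
    StronglyMeasurable (barDiff f) := by
  have h1 : StronglyMeasurable fun g : Fin (n + 1) → G => g 0 :=
    (measurable_pi_apply 0).stronglyMeasurable
  exact (h1.smul (hf.comp_measurable measurable_tail)).add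
    (Finset.stronglyMeasurable_fun_sum _ fun j _ =>
      (hf.comp_measurable (measurable_contractNth j)).const_smul ((-1 : ℤ) ^ ((j : ℕ) + 1)))

theorem stronglyMeasurable_cone {r n : ℕ} (hr : r ≤ n) {ζ : (Fin r → G) → G}
    (hζ : Measurable ζ) {f : (Fin (n + 1) → G) → A} (hf : StronglyMeasurable f) :
    StronglyMeasurable (cone hr ζ f) :=
  (hf.comp_measurable ((measurable_insertAt hr).comp
    ((hζ.comp (measurable_initial hr)).prodMk measurable_id))).const_smul ((-1 : ℤ) ^ (r + 1))

variable {ρ : A → ℝ}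

theorem InvariantSize.measurableSet_lt (hρ : InvariantSize G ρ) {n : ℕ} {f : (Fin n → G) → A}
    (hf : StronglyMeasurable f) (δ : ℝ) : MeasurableSet {g | δ < ρ (f g)} := by
  borelize A
  have : {g | δ < ρ (f g)} = (f ⁻¹' {a | ρ a ≤ δ})ᶜ := by ext g; simp
  rw [this]
  exact (hf.measurable (hρ.isClosed_le δ).measurableSet).compl

/-- Outside two exceptional sets, each of conditional probability at most `3(r + 2)ε`, both head
sums in the cone identity have size at most `(r + 2)δ`. This explains the constants. -/
theorem InvariantSize.exists_sub_barDiff_smallAt_succ (hρ : InvariantSize G ρ) {r n : ℕ}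
    (hr : r + 1 ≤ n) {f : (Fin (n + 1) → G) → A} (hf : StronglyMeasurable f)
    (hd : barDiff f =ᵐ[haarPow G (n + 2)] 0) {ε : ℝ≥0∞} {δ : ℝ}
    (h : SmallAt r ε {g | δ < ρ (f g)}) :
    ∃ ψ : (Fin n → G) → A, StronglyMeasurable ψ ∧
      SmallAt (r + 1) (6 * (r + 2 : ℕ) * ε)
        {g | 2 * (r + 2) * δ < ρ ((f - barDiff ψ) g)} := by
  have hM := hρ.measurableSet_lt hf δ
  set M := {g | δ < ρ (f g)} with hMdef
  set Z : Set (Fin (n + 2) → G) := toMeasurable (haarPow G (n + 2)) {g | ¬ barDiff f g = 0}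
  have hZ0 : haarPow G (n + 2) Z = 0 := by
    rw [measure_toMeasurable]; exact hd
  have hN : MeasurableSet (headFaces r M ∪ Z) :=
    (measurableSet_headFaces r hM).union (measurableSet_toMeasurable _ _)
  -- The null set `Z` joins the exceptional set because the cocycle identity is used at inserted
  -- tuples, where it is not automatic.
  have hNs : SmallAt (r + 1) ((r + 2 : ℕ) * ε) (headFaces r M ∪ Z) := by
    simpa using (h.headFaces (by omega) hM).union (smallAt_of_null (r + 1) hZ0)
  obtain ⟨ζ, hζ, hζN, hζM⟩ := exists_insertion_point (by omega : r + 1 ≤ n + 1) hr hN hM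
  have hψ := stronglyMeasurable_cone hr hζ hf
  refine ⟨cone hr ζ f, hψ, ?_⟩
  have hN' : SmallAt (r + 1) (3 * ((r + 2 : ℕ) * ε))
      {g : Fin (n + 1) → G | insertAt (by omega : r + 1 ≤ n + 1)
        (ζ (initial (by omega) g)) g ∈ headFaces r M ∪ Z} := by
    filter_upwards [hζN, hNs] with u hu hu'
    simp only [initial_splice]
    exact hu.trans (by gcongr)
  have hK : SmallAt (r + 1) ((r + 2 : ℕ) * (3 * ε)) (headFaces r {g | δ < ρ (cone hr ζ f g)}) := by
    refine SmallAt.headFaces (by omega) (hρ.measurableSet_lt hψ δ) ?_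
    refine (h.insertAt hr hM hζ hζM).mono (fun g hg => ?_) le_rfl
    have hg' : δ < ρ (cone hr ζ f g) := hg
    rw [cone, hρ.neg_one_pow_smul] at hg'
    exact hg'
  refine (hN'.union hK).mono (fun g hg => ?_) (le_of_eq (by ring))
  by_contra hcon
  rw [Set.mem_union, not_or] at hcon
  obtain ⟨h1, h2⟩ := hcon
  have h1' : insertAt (by omega : r + 1 ≤ n + 1) (ζ (initial (by omega) g)) g ∉
    headFaces r M ∪ Z := h1
  rw [Set.mem_union, not_or] at h1'
  have h3 : barDiff f (insertAt (by omega : r + 1 ≤ n + 1) (ζ (initial (by omega) g)) g) = 0 := by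
    by_contra hne
    exact h1'.2 (subset_toMeasurable _ _ hne)
  have h4 : 2 * ((r : ℝ) + 2) * δ < ρ (f g - barDiff (cone hr ζ f) g) := hg
  rw [sub_barDiff_cone, h3, zero_sub] at h4
  have h5 := hρ.sub_le ((-1 : ℤ) ^ r •
    (-headSum r f (insertAt (by omega : r + 1 ≤ n + 1) (ζ (initial (by omega) g)) g)))
    (headSum r (cone hr ζ f) g)
  rw [hρ.neg_one_pow_smul, hρ.neg] at h5
  have h6 := hρ.headSum_le (by omega) h1'.1
  have h7 := hρ.headSum_le (by omega) h2
  linarith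

/-- In the cocycle identity at `(u, y)` the last face is `u` itself. The other `n + 2` faces are all
small for some `y`, since the bad `y` have measure less than `1`. -/
theorem InvariantSize.ae_le_of_smallAt (hρ : InvariantSize G ρ) {n : ℕ}
    {f : (Fin (n + 1) → G) → A} (hf : StronglyMeasurable f)
    (hd : barDiff f =ᵐ[haarPow G (n + 2)] 0) {ε : ℝ≥0∞} {δ : ℝ}
    (h : SmallAt n ε {g | δ < ρ (f g)}) (hε : (n + 2 : ℕ) * ε < 1) :
    ∀ᵐ g ∂haarPow G (n + 1), ρ (f g) ≤ (n + 2) * δ := by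
  have hNs := (h.headFaces (by omega) (hρ.measurableSet_lt hf δ)).union
    (smallAt_of_null (n + 1) (N := {g | ¬ barDiff f g = 0}) hd)
  filter_upwards [hNs] with u hu
  rw [add_zero] at hu
  obtain ⟨w, hw⟩ : ∃ w : Fin (n + 2) → G, splice u w ∉
      headFaces n {g | δ < ρ (f g)} ∪ {g | ¬ barDiff f g = 0} := by
    by_contra! hcon
    have : {w : Fin (n + 2) → G | splice u w ∈
      headFaces n {g | δ < ρ (f g)} ∪ {g | ¬ barDiff f g = 0}} = Set.univ :=
      Set.eq_univ_of_forall hcon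
    rw [this, measure_univ] at hu
    exact absurd hε (not_lt.2 hu)
  rw [Set.mem_union, not_or] at hw
  have h3 : barDiff f (splice u w) = 0 := not_not.1 hw.2
  rw [← headSum_add_tailSum n, tailSum, Fin.sum_univ_castSucc, Finset.sum_eq_zero, zero_add] at h3
  · have h4 : Fin.contractNth (Fin.last (n + 1)) (· * ·) (splice u w) = u := by
      funext i
      have h5 : ((i : Fin (n + 1)) : ℕ) < Fin.last (n + 1) := i.2
      rw [Fin.contractNth_apply_of_lt _ _ _ _ h5]
      simp [splice]
      omega
    rw [h4, if_neg (by simp), add_eq_zero_iff_eq_neg] at h3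
    have h6 := hρ.headSum_le (by omega) hw.1
    rwa [h3, hρ.neg, hρ.neg_one_pow_smul] at h6
  · intro j _
    exact if_pos (Nat.lt_succ_iff.1 j.2)

end Reduction

/-! ### From smallness in probability to smallness almost everywhere -/

section Reduction

variable {G : Type*} [Group G] [TopologicalSpace G] [IsTopologicalGroup G] [CompactSpace G]
  [T2Space G] [SecondCountableTopology G] [MeasurableSpace G] [BorelSpace G]
variable {A : Type*} [AddCommGroup A] [TopologicalSpace A] [IsTopologicalAddGroup A]
  [PolishSpace A] [DistribMulAction G A] [ContinuousSMul G A] {ρ : A → ℝ}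

theorem barDiff_sub_barDiff {n : ℕ} (f : (Fin (n + 1) → G) → A) (ψ : (Fin n → G) → A) :
    barDiff (f - barDiff ψ) = barDiff f := by
  conv_rhs => rw [← sub_add_cancel f (barDiff ψ), barDiff_add, barDiff_barDiff, add_zero]

theorem InvariantSize.exists_sub_barDiff_smallAt (hρ : InvariantSize G ρ) (n : ℕ) {r : ℕ}
    (hr : r ≤ n) : ∃ C D : ℕ, ∀ f : (Fin (n + 1) → G) → A, StronglyMeasurable f →
      barDiff f =ᵐ[haarPow G (n + 2)] 0 → ∀ (ε : ℝ≥0∞) (δ : ℝ),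
      haarPow G (n + 1) {g | δ < ρ (f g)} ≤ ε →
      ∃ ψ : (Fin n → G) → A, StronglyMeasurable ψ ∧
        SmallAt r (C * ε) {g | D * δ < ρ ((f - barDiff ψ) g)} := by
  induction r with
  | zero =>
    refine ⟨1, 1, fun f hf hd ε δ h => ⟨0, stronglyMeasurable_const, ?_⟩⟩
    have h0 : barDiff (0 : (Fin n → G) → A) = 0 := by funext g; simp [barDiff]
    simpa [h0] using smallAt_zero h
  | succ r ih =>
    obtain ⟨C, D, hCD⟩ := ih (by omega)
    refine ⟨6 * (r + 2) * C, 2 * (r + 2) * D, fun f hf hd ε δ h => ?_⟩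
    obtain ⟨ψ, hψ, hs⟩ := hCD f hf hd ε δ h
    obtain ⟨ψ', hψ', hs'⟩ := hρ.exists_sub_barDiff_smallAt_succ hr
      (hf.sub (stronglyMeasurable_barDiff hψ)) (by rwa [barDiff_sub_barDiff]) hs
    refine ⟨ψ + ψ', hψ.add hψ', hs'.mono (fun g hg => ?_) (le_of_eq ?_)⟩
    · rw [barDiff_add, ← sub_sub] at hg
      have hg' : ((2 * (r + 2) * D : ℕ) : ℝ) * δ < ρ ((f - barDiff ψ - barDiff ψ') g) := hg
      push_cast at hg'
      change 2 * ((r : ℝ) + 2) * (D * δ) < ρ ((f - barDiff ψ - barDiff ψ') g)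
      linarith
    · push_cast
      ring

/-- A measurable cocycle which is small with high probability is cohomologous to one which is
small almost everywhere. -/
theorem InvariantSize.exists_sub_barDiff_ae_le (hρ : InvariantSize G ρ) (n : ℕ) :
    ∃ ε : ℝ≥0∞, 0 < ε ∧ ∃ D : ℕ, ∀ f : (Fin (n + 1) → G) → A, StronglyMeasurable f →
      barDiff f =ᵐ[haarPow G (n + 2)] 0 → ∀ δ : ℝ,
      haarPow G (n + 1) {g | δ < ρ (f g)} < ε →
      ∃ ψ : (Fin n → G) → A, StronglyMeasurable ψ ∧
        ∀ᵐ g ∂haarPow G (n + 1), ρ ((f - barDiff ψ) g) ≤ D * δ := by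
  obtain ⟨C, D, hCD⟩ := hρ.exists_sub_barDiff_smallAt n le_rfl
  -- This value makes `(n + 2) * C * ε < 1`, as the final step requires.
  refine ⟨(((n + 2) * C + 1 : ℕ) : ℝ≥0∞)⁻¹, ENNReal.inv_pos.2 (ENNReal.natCast_ne_top _),
    (n + 2) * D, fun f hf hd δ h => ?_⟩
  obtain ⟨ψ, hψ, hs⟩ := hCD f hf hd _ δ h.le
  refine ⟨ψ, hψ, ?_⟩
  have hlt : (n + 2 : ℕ) * (C * (((n + 2) * C + 1 : ℕ) : ℝ≥0∞)⁻¹) < 1 := by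
    rw [← mul_assoc, ← Nat.cast_mul, ← div_eq_mul_inv]
    refine ENNReal.div_lt_of_lt_mul ?_
    rw [one_mul]
    exact_mod_cast Nat.lt_succ_self _
  filter_upwards [hρ.ae_le_of_smallAt (hf.sub (stronglyMeasurable_barDiff hψ))
    (by rwa [barDiff_sub_barDiff]) hs hlt] with g hg
  push_cast
  linarith

end Reduction

/-! ### Lifting a torus and the action on it -/

section Torus

/-- A continuous homomorphism from a real normed space to the circle lifts to a linear form. -/
theorem exists_continuousLinearMap_coe_eq {V : Type*} [NormedAddCommGroup V] [NormedSpace ℝ V]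
    (α : V →+ AddCircle (1 : ℝ)) (hα : Continuous α) :
    ∃ L : V →L[ℝ] ℝ, ∀ x, (L x : AddCircle (1 : ℝ)) = α x := by
  obtain ⟨F, ⟨hF0, hF⟩, -⟩ := (AddCircle.isCoveringMap_coe (1 : ℝ)).existsUnique_continuousMap_lifts
    ⟨α, hα⟩ 0 0 (by simp)
  have hF' : ∀ x, (F x : AddCircle (1 : ℝ)) = α x := fun x => congrFun hF x
  have hadd : ∀ x y, F (x + y) = F x + F y := by
    -- The defect of additivity is continuous and integer-valued on a connected space, hence
    -- constant, and it vanishes at the origin.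
    have hc : Continuous fun z : V × V => F (z.1 + z.2) - F z.1 - F z.2 := by fun_prop
    have hint : ∀ z : V × V, ∃ k : ℤ, (k : ℝ) = F (z.1 + z.2) - F z.1 - F z.2 := fun z => by
      have h0 : ((F (z.1 + z.2) - F z.1 - F z.2 : ℝ) : AddCircle (1 : ℝ)) = 0 := by
        rw [AddCircle.coe_sub, AddCircle.coe_sub, hF', hF', hF', map_add]
        abel
      obtain ⟨k, hk⟩ := (AddCircle.coe_eq_zero_iff (1 : ℝ)).1 h0
      exact ⟨k, by simpa using hk⟩
    choose k hk using hint
    have hkc : Continuous k := by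
      rw [Int.isClosedEmbedding_coe_real.isInducing.continuous_iff]
      exact hc.congr fun z => (hk z).symm
    intro x y
    have h1 : k (x, y) = k (0, 0) := PreconnectedSpace.constant inferInstance hkc
    have h2 := hk (x, y)
    rw [h1, hk (0, 0)] at h2
    simp only [add_zero, hF0] at h2
    linarith
  let F' : V →+ ℝ := AddMonoidHom.mk' F hadd
  exact ⟨F'.toRealLinearMap F.continuous, hF'⟩

theorem norm_coe_torus {n : ℕ} {x : Fin n → ℝ} (hx : ‖x‖ ≤ 1 / 2) :
    ‖fun i => (x i : AddCircle (1 : ℝ))‖ = ‖x‖ := by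
  have h : ∀ i, ‖(x i : AddCircle (1 : ℝ))‖ = ‖x i‖ := fun i => by
    rw [Real.norm_eq_abs, AddCircle.norm_coe_eq_abs_iff 1 one_ne_zero]
    simpa using (norm_le_pi_norm x i).trans hx
  refine le_antisymm ((pi_norm_le_iff_of_nonneg (norm_nonneg _)).2 fun i => ?_)
    ((pi_norm_le_iff_of_nonneg (norm_nonneg _)).2 fun i => ?_)
  · rw [h]
    exact norm_le_pi_norm x i
  · rw [← h]
    exact norm_le_pi_norm (fun i => (x i : AddCircle (1 : ℝ))) i

theorem norm_torus_le {n : ℕ} (x : Fin n → AddCircle (1 : ℝ)) : ‖x‖ ≤ 1 / 2 :=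
  (pi_norm_le_iff_of_nonneg (by norm_num)).2 fun i => by
    simpa using AddCircle.norm_le_half_period (1 : ℝ) (x := x i) one_ne_zero

variable {G : Type*} [Group G] [TopologicalSpace G] [CompactSpace G]
variable {A : Type*} [AddCommGroup A] [TopologicalSpace A] [DistribMulAction G A]
  [ContinuousSMul G A] {n : ℕ} (e : A ≃ₜ+ (Fin n → AddCircle (1 : ℝ)))

/-- The largest distance from `0` to a point of the orbit. -/
noncomputable def orbitNorm (G : Type*) [Group G] [DistribMulAction G A]
    (e : A ≃ₜ+ (Fin n → AddCircle (1 : ℝ))) (a : A) : ℝ :=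
  ⨆ g : G, ‖e (g • a)‖

theorem orbitNorm_le_iff {a : A} {δ : ℝ} : orbitNorm G e a ≤ δ ↔ ∀ g : G, ‖e (g • a)‖ ≤ δ :=
  ciSup_le_iff ⟨1 / 2, by rintro _ ⟨g, rfl⟩; exact norm_torus_le _⟩

theorem norm_smul_le_orbitNorm (g : G) (a : A) : ‖e (g • a)‖ ≤ orbitNorm G e a :=
  (orbitNorm_le_iff e).1 le_rfl g

theorem norm_le_orbitNorm (a : A) : ‖e a‖ ≤ orbitNorm G e a := by
  simpa using norm_smul_le_orbitNorm e (1 : G) a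

theorem invariantSize_orbitNorm : InvariantSize G (orbitNorm G e) where
  zero := by simp [orbitNorm]
  add_le a b := (orbitNorm_le_iff e).2 fun g => by
    rw [smul_add, map_add]
    exact (norm_add_le _ _).trans
      (add_le_add (norm_smul_le_orbitNorm e g a) (norm_smul_le_orbitNorm e g b))
  neg a := by simp [orbitNorm]
  smul h a := by
    refine le_antisymm ((orbitNorm_le_iff e).2 fun g => ?_) ((orbitNorm_le_iff e).2 fun g => ?_)
    · rw [smul_smul]
      exact norm_smul_le_orbitNorm e _ a
    · have := norm_smul_le_orbitNorm e (g * h⁻¹) (h • a)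
      rwa [smul_smul, inv_mul_cancel_right] at this
  isClosed_le δ := by
    simp only [orbitNorm_le_iff, Set.ofPred_forall]
    exact isClosed_iInter fun g => isClosed_le (by fun_prop) continuous_const

/-- Compactness of `G` makes the continuity of the action at `0` uniform over the group. -/
theorem eventually_orbitNorm_le {δ : ℝ} (hδ : 0 < δ) : ∀ᶠ a in 𝓝 (0 : A), orbitNorm G e a ≤ δ := by
  have h := (isCompact_univ (X := G)).eventually_forall_of_forall_eventually (x₀ := (0 : A))
    (P := fun a g => ‖e (g • a)‖ < δ) fun g _ => by
      have hc : Continuous fun z : A × G => ‖e (z.2 • z.1)‖ := by fun_prop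
      exact hc.continuousAt.eventually_lt continuousAt_const (by simpa using hδ)
  filter_upwards [h] with a ha
  exact (orbitNorm_le_iff e).2 fun g => (ha g (Set.mem_univ _)).le

theorem exists_orbitNorm_le_of_norm_le {δ : ℝ} (hδ : 0 < δ) :
    ∃ η > 0, ∀ a : A, ‖e a‖ ≤ η → orbitNorm G e a ≤ δ := by
  have h : ∀ᶠ b in 𝓝 (0 : Fin n → AddCircle (1 : ℝ)), orbitNorm G e (e.symm b) ≤ δ := by
    have hc : Filter.Tendsto e.symm (𝓝 0) (𝓝 (0 : A)) := by
      have h0 := e.symm.continuous.tendsto 0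
      rwa [show e.symm.toHomeomorph 0 = 0 from map_zero e.symm] at h0
    exact hc.eventually (eventually_orbitNorm_le e hδ)
  obtain ⟨η, hη, hs⟩ := Metric.nhds_basis_closedBall.eventually_iff.1 h
  refine ⟨η, hη, fun a ha => ?_⟩
  simpa using hs (x := e a) (by simpa using ha)

/-- The universal covering of a torus. -/
noncomputable def torusExp : (Fin n → ℝ) →+ A :=
  AddMonoidHom.mk' (fun x => e.symm fun i => (x i : AddCircle (1 : ℝ))) fun x y => by
    rw [← map_add]
    rfl

theorem apply_torusExp (x : Fin n → ℝ) : e (torusExp e x) = fun i => (x i : AddCircle (1 : ℝ)) :=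
  e.apply_symm_apply _

theorem continuous_torusExp : Continuous (torusExp e) :=
  e.symm.continuous.comp (continuous_pi fun i =>
    (AddCircle.continuous_mk' (1 : ℝ)).comp (continuous_apply i))

theorem torusExp_neg_one_pow_smul (k : ℕ) (x : Fin n → ℝ) :
    torusExp e ((-1 : ℝ) ^ k • x) = (-1 : ℤ) ^ k • torusExp e x := by
  rcases Nat.even_or_odd k with hk | hk <;> simp [hk.neg_one_pow]

/-- The lift of a point of a torus with coordinates in `[-1/2, 1/2)`. -/
noncomputable def torusLog (a : A) : Fin n → ℝ := fun i =>
  AddCircle.measurableEquivIco (1 : ℝ) (-(1 / 2)) (e a i)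

theorem torusExp_torusLog (a : A) : torusExp e (torusLog e a) = a := by
  apply e.injective
  rw [apply_torusExp]
  funext i
  have : Fact (0 < (1 : ℝ)) := ⟨one_pos⟩
  exact AddCircle.coe_equivIco (p := (1 : ℝ)) (a := -(1 / 2)) (y := e a i)

theorem norm_torusLog (a : A) : ‖torusLog e a‖ = ‖e a‖ := by
  have h : ‖torusLog e a‖ ≤ 1 / 2 := (pi_norm_le_iff_of_nonneg (by norm_num)).2 fun i => by
    have := (AddCircle.measurableEquivIco (1 : ℝ) (-(1 / 2)) (e a i)).2
    rw [Real.norm_eq_abs, abs_le]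
    exact ⟨this.1, by have := this.2; simp only [torusLog]; linarith⟩
  rw [← norm_coe_torus h, ← apply_torusExp e, torusExp_torusLog]

theorem measurable_torusLog [MeasurableSpace A] [BorelSpace A] : Measurable (torusLog e) :=
  measurable_pi_lambda _ fun i => measurable_subtype_coe.comp
    ((AddCircle.measurableEquivIco (1 : ℝ) (-(1 / 2))).measurable.comp
      ((measurable_pi_apply i).comp e.continuous.measurable))

theorem exists_torusExp_lift_smul (g : G) : ∃ L : (Fin n → ℝ) →L[ℝ] (Fin n → ℝ),
    ∀ x, torusExp e (L x) = g • torusExp e x := by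
  have h : ∀ i, ∃ L : (Fin n → ℝ) →L[ℝ] ℝ, ∀ x,
      (L x : AddCircle (1 : ℝ)) = e (g • torusExp e x) i := fun i =>
    exists_continuousLinearMap_coe_eq
      (AddMonoidHom.mk' (fun x => e (g • torusExp e x) i) fun x y => by simp) (by
        have := continuous_torusExp e
        change Continuous fun x => e (g • torusExp e x) i
        fun_prop)
  choose L hL using h
  refine ⟨ContinuousLinearMap.pi L, fun x => e.injective ?_⟩
  rw [apply_torusExp]
  funext i
  exact hL i x

/-- A linear lift of the action is controlled near `0` by the size of orbits. -/
theorem norm_lift_le {η : ℝ} (hη : ∀ a : A, ‖e a‖ ≤ η → orbitNorm G e a ≤ 1 / 4)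
    (hη' : η ≤ 1 / 2) {g : G} {L : (Fin n → ℝ) →L[ℝ] (Fin n → ℝ)}
    (hL : ∀ x, torusExp e (L x) = g • torusExp e x) {x : Fin n → ℝ} (hx : ‖x‖ ≤ η) :
    ‖L x‖ ≤ orbitNorm G e (torusExp e x) := by
  have key : ‖L x‖ ≤ 1 / 4 := by
    by_contra! hlt
    -- If `L x` were long, shrinking `x` would bring its image to a norm in `(1/4, 1/2]`. There the
    -- torus norm equals the true norm, contradicting `hη`.
    obtain ⟨t, ht0, ht1, ht2, ht3⟩ :
        ∃ t : ℝ, 0 ≤ t ∧ t ≤ 1 ∧ 1 / 4 < t * ‖L x‖ ∧ t * ‖L x‖ ≤ 1 / 2 := by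
      rcases le_or_gt ‖L x‖ (1 / 2) with h | h
      · exact ⟨1, by simp, le_rfl, by linarith, by linarith⟩
      · have h0 : 0 < ‖L x‖ := by linarith
        have h1 := div_mul_cancel₀ (1 / 2) h0.ne'
        exact ⟨1 / 2 / ‖L x‖, by positivity, (div_le_one h0).2 h.le, by linarith, h1.le⟩
    have hn : ∀ y : Fin n → ℝ, ‖t • y‖ = t * ‖y‖ := fun y => by
      rw [norm_smul, Real.norm_of_nonneg ht0]
    have h1 : ‖L (t • x)‖ = t * ‖L x‖ := by rw [map_smul, hn]
    have h2 : ‖t • x‖ ≤ η := by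
      rw [hn]
      exact (mul_le_of_le_one_left (norm_nonneg _) ht1).trans hx
    have h3 : ‖e (torusExp e (t • x))‖ ≤ η := by
      rwa [apply_torusExp, norm_coe_torus (h2.trans hη')]
    have h4 := (norm_smul_le_orbitNorm e g _).trans (hη _ h3)
    rw [← hL, apply_torusExp, norm_coe_torus (by linarith), h1] at h4
    linarith
  have h := norm_smul_le_orbitNorm e g (torusExp e x)
  rwa [← hL, apply_torusExp, norm_coe_torus (by linarith)] at h

end Torus

/-! ### Averaging a lifted cocycle -/

section Average

variable {G : Type*} [Group G] [TopologicalSpace G] [IsTopologicalGroup G] [CompactSpace G]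
  [T2Space G] [SecondCountableTopology G] [MeasurableSpace G] [BorelSpace G]

theorem tail_snoc {m : ℕ} (g : Fin (m + 1) → G) (y : G) :
    (fun i : Fin (m + 1) => (Fin.snoc (α := fun _ => G) g y : Fin (m + 2) → G) i.succ) =
      Fin.snoc (α := fun _ => G) (fun i : Fin m => g i.succ) y := by
  funext i
  refine Fin.lastCases ?_ (fun i => ?_) i
  · rw [Fin.succ_last, Fin.snoc_last, Fin.snoc_last]
  · rw [Fin.succ_castSucc, Fin.snoc_castSucc, Fin.snoc_castSucc]

theorem contractNth_last_snoc {m : ℕ} (g : Fin m → G) (y : G) :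
    Fin.contractNth (Fin.last m) (· * ·) (Fin.snoc (α := fun _ => G) g y) = g := by
  funext i
  rw [Fin.contractNth_apply_of_lt _ _ _ _ (by simp), Fin.snoc_castSucc]

/-- The appended `y` is at most left-translated, which integration over `y` does not notice. -/
theorem contractNth_castSucc_snoc {m : ℕ} (g : Fin (m + 1) → G) (y : G) (j : Fin (m + 1)) :
    Fin.contractNth j.castSucc (· * ·) (Fin.snoc (α := fun _ => G) g y) =
      Fin.snoc (α := fun _ => G) (Fin.contractNth j (· * ·) g)
        ((if j = Fin.last m then g (Fin.last m) else 1) * y) := by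
  funext i
  refine Fin.lastCases ?_ (fun i => ?_) i
  · rw [Fin.snoc_last]
    by_cases hj : j = Fin.last m
    · subst hj
      rw [Fin.contractNth_apply_of_eq _ _ _ _ (by simp), Fin.snoc_castSucc, Fin.succ_last,
        Fin.snoc_last, if_pos rfl]
    · have h : (j : ℕ) < m := by
        have := j.2
        have : (j : ℕ) ≠ m := fun h => hj (Fin.ext h)
        omega
      rw [Fin.contractNth_apply_of_gt _ _ _ _ (by simpa using h), Fin.succ_last, Fin.snoc_last,
        if_neg hj, one_mul]
  · rw [Fin.snoc_castSucc]
    rcases lt_trichotomy (i : ℕ) j with h | h | h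
    · rw [Fin.contractNth_apply_of_lt _ _ _ _ (by simpa using h),
        Fin.contractNth_apply_of_lt _ _ _ _ h, Fin.snoc_castSucc]
    · rw [Fin.contractNth_apply_of_eq _ _ _ _ (by simpa using h),
        Fin.contractNth_apply_of_eq _ _ _ _ h, Fin.snoc_castSucc, Fin.succ_castSucc,
        Fin.snoc_castSucc]
    · rw [Fin.contractNth_apply_of_gt _ _ _ _ (by simpa using h),
        Fin.contractNth_apply_of_gt _ _ _ _ h, Fin.succ_castSucc, Fin.snoc_castSucc]

theorem measurable_snoc {m : ℕ} : Measurable fun x : (Fin m → G) × G =>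
    (Fin.snoc (α := fun _ => G) x.1 x.2 : Fin (m + 1) → G) :=
  (measurePreserving_snoc m).measurable

variable {A : Type*} [AddCommGroup A] [TopologicalSpace A] [IsTopologicalAddGroup A]
  [PolishSpace A] [DistribMulAction G A] [ContinuousSMul G A] {n : ℕ}
  (e : A ≃ₜ+ (Fin n → AddCircle (1 : ℝ)))

/-- The lifted expression maps to `0` in the torus and has norm at most `(m + 2)δ ≤ 1/2`, a range
where the covering preserves norms; so it is `0`. -/
theorem barDiff_torusLog_eq_zero {η : ℝ} (hη : ∀ a : A, ‖e a‖ ≤ η → orbitNorm G e a ≤ 1 / 4)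
    (hη' : η ≤ 1 / 2) {L : G → (Fin n → ℝ) →L[ℝ] (Fin n → ℝ)}
    (hL : ∀ g x, torusExp e (L g x) = g • torusExp e x) {m : ℕ} {f : (Fin m → G) → A}
    {δ : ℝ} (hδη : δ ≤ η) (hδ : (m + 2) * δ ≤ 1 / 2) {w : Fin (m + 1) → G}
    (h0 : orbitNorm G e (f fun i => w i.succ) ≤ δ)
    (hj : ∀ j : Fin (m + 1), orbitNorm G e (f (Fin.contractNth j (· * ·) w)) ≤ δ)
    (hw : barDiff f w = 0) :
    L (w 0) (torusLog e (f fun i => w i.succ)) + ∑ j : Fin (m + 1),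
      (-1 : ℝ) ^ ((j : ℕ) + 1) • torusLog e (f (Fin.contractNth j (· * ·) w)) = 0 := by
  set X := L (w 0) (torusLog e (f fun i => w i.succ)) + ∑ j : Fin (m + 1),
      (-1 : ℝ) ^ ((j : ℕ) + 1) • torusLog e (f (Fin.contractNth j (· * ·) w)) with hX
  have hexp : torusExp e X = 0 := by
    rw [hX, map_add, map_sum, hL, ← hw, barDiff, torusExp_torusLog]
    simp only [torusExp_neg_one_pow_smul, torusExp_torusLog]
  have hlog : ∀ a, orbitNorm G e a ≤ δ → ‖torusLog e a‖ ≤ δ := fun a ha => by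
    rw [norm_torusLog]
    exact (norm_le_orbitNorm e a).trans ha
  have h1 : ‖L (w 0) (torusLog e (f fun i => w i.succ))‖ ≤ δ := by
    have := norm_lift_le e hη hη' (hL (w 0)) ((hlog _ h0).trans hδη)
    rw [torusExp_torusLog] at this
    exact this.trans h0
  have h2 : ‖∑ j : Fin (m + 1), (-1 : ℝ) ^ ((j : ℕ) + 1) •
      torusLog e (f (Fin.contractNth j (· * ·) w))‖ ≤ (m + 1) * δ := by
    refine (norm_sum_le_of_le _ (n := fun _ => δ) fun j _ => ?_).trans (by simp)
    rw [norm_smul, norm_pow, norm_neg, norm_one, one_pow, one_mul]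
    exact hlog _ (hj j)
  have h3 : ‖X‖ ≤ 1 / 2 := (norm_add_le _ _).trans (by linarith)
  rw [← norm_eq_zero, ← norm_coe_torus h3, ← apply_torusExp e, hexp, map_zero, norm_zero]

/-- A torus-valued cocycle which is small almost everywhere is a coboundary. -/
theorem exists_ae_eq_barDiff_of_orbitNorm_le {η : ℝ}
    (hη : ∀ a : A, ‖e a‖ ≤ η → orbitNorm G e a ≤ 1 / 4) (hη' : η ≤ 1 / 2) {m : ℕ}
    {f : (Fin (m + 1) → G) → A} (hf : StronglyMeasurable f)
    (hd : barDiff f =ᵐ[haarPow G (m + 2)] 0) {δ : ℝ} (hδη : δ ≤ η)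
    (hδ : (m + 3) * δ ≤ 1 / 2) (h : ∀ᵐ g ∂haarPow G (m + 1), orbitNorm G e (f g) ≤ δ) :
    ∃ ψ : (Fin m → G) → A, StronglyMeasurable ψ ∧ f =ᵐ[haarPow G (m + 1)] barDiff ψ := by
  borelize A
  -- The lifts are chosen separately for each `g`. Measurability in `g` is not needed, as `g` stays
  -- fixed while the last variable is integrated.
  choose L hL using exists_torusExp_lift_smul (G := G) e
  set F : (Fin (m + 1) → G) → Fin n → ℝ := fun g => torusLog e (f g) with hF
  have hFm : Measurable F := (measurable_torusLog e).comp hf.measurable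
  have hFb : ∀ g, ‖F g‖ ≤ 1 / 2 := fun g => by
    rw [hF, norm_torusLog]
    exact norm_torus_le _
  have hFi : ∀ (k : (Fin m → G)) (c : G), Integrable
      (fun y => F (Fin.snoc (α := fun _ => G) k (c * y))) (haarProb G) := fun k c =>
    Integrable.of_bound ((hFm.comp measurable_snoc).comp
      (measurable_const.prodMk (measurable_const_mul c))).aestronglyMeasurable (1 / 2)
      (Filter.Eventually.of_forall fun y => hFb _)
  let Ψ : (Fin m → G) → Fin n → ℝ := fun k =>
    ∫ y, F (Fin.snoc (α := fun _ => G) k y) ∂haarProb G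
  have hΨ : StronglyMeasurable Ψ :=
    StronglyMeasurable.integral_prod_right'
      (f := fun x : (Fin m → G) × G => F (Fin.snoc (α := fun _ => G) x.1 x.2))
      (hFm.comp measurable_snoc).stronglyMeasurable
  have hΨc : ∀ (k : (Fin m → G)) (c : G),
      ∫ y, F (Fin.snoc (α := fun _ => G) k (c * y)) ∂haarProb G = Ψ k := fun k c =>
    integral_mul_left_eq_self (fun y => F (Fin.snoc (α := fun _ => G) k y)) c
  refine ⟨fun k => (-1 : ℤ) ^ (m + 1) • torusExp e (Ψ k),
    ((continuous_torusExp e).comp_stronglyMeasurable hΨ).const_smul ((-1 : ℤ) ^ (m + 1)), ?_⟩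
  have hw : ∀ᵐ w ∂haarPow G (m + 2), L (w 0) (F fun i => w i.succ) + ∑ j : Fin (m + 2),
      (-1 : ℝ) ^ ((j : ℕ) + 1) • F (Fin.contractNth j (· * ·) w) = 0 := by
    filter_upwards [hd, (measurePreserving_tail (G := G) (m + 1)).quasiMeasurePreserving.ae h,
      ae_all_iff.2 fun j : Fin (m + 2) =>
        (measurePreserving_contractNth (G := G) (m + 1) j).quasiMeasurePreserving.ae h]
      with w h1 h2 h3
    exact barDiff_torusLog_eq_zero e hη hη' hL hδη (by push_cast; linarith) h2 h3 h1
  have hgy := Measure.ae_ae_of_ae_prod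
    ((measurePreserving_snoc (G := G) (m + 1)).quasiMeasurePreserving.ae hw)
  filter_upwards [hgy] with g hg
  -- Only the last face is independent of `y`, so the integral isolates `F g`. The factor `1 * y`
  -- puts every other term in the form covered by `hΨc`.
  have hint : ∫ y, (L (g 0) (F (Fin.snoc (α := fun _ => G) (fun i : Fin m => g i.succ) (1 * y))) +
      ∑ j : Fin (m + 1), (-1 : ℝ) ^ ((j : ℕ) + 1) •
        F (Fin.snoc (α := fun _ => G) (Fin.contractNth j (· * ·) g)
          ((if j = Fin.last m then g (Fin.last m) else 1) * y)) +
      (-1 : ℝ) ^ (m + 2) • F g) ∂haarProb G = 0 := by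
    refine integral_eq_zero_of_ae ?_
    filter_upwards [hg] with y hy
    rw [Fin.sum_univ_castSucc] at hy
    simp only [tail_snoc, contractNth_last_snoc, contractNth_castSucc_snoc] at hy
    simp only [Pi.zero_apply, one_mul]
    rw [← hy, add_assoc]
    congr 1
  have i1 : Integrable (fun y => L (g 0)
      (F (Fin.snoc (α := fun _ => G) (fun i : Fin m => g i.succ) (1 * y)))) (haarProb G) :=
    (L (g 0)).integrable_comp (hFi _ _)
  have i2 : ∀ j : Fin (m + 1), Integrable (fun y => (-1 : ℝ) ^ ((j : ℕ) + 1) •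
        F (Fin.snoc (α := fun _ => G) (Fin.contractNth j (· * ·) g)
          ((if j = Fin.last m then g (Fin.last m) else 1) * y))) (haarProb G) := fun j =>
    (hFi _ _).smul ((-1 : ℝ) ^ ((j : ℕ) + 1))
  have i3 := integrable_finsetSum Finset.univ fun j _ => i2 j
  have i4 : Integrable (fun y => L (g 0)
      (F (Fin.snoc (α := fun _ => G) (fun i : Fin m => g i.succ) (1 * y))) +
      ∑ j : Fin (m + 1), (-1 : ℝ) ^ ((j : ℕ) + 1) •
        F (Fin.snoc (α := fun _ => G) (Fin.contractNth j (· * ·) g)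
          ((if j = Fin.last m then g (Fin.last m) else 1) * y))) (haarProb G) := i1.add i3
  rw [integral_add i4 (integrable_const _), integral_add i1 i3,
    integral_finsetSum _ fun j _ => i2 j, ContinuousLinearMap.integral_comp_comm _ (hFi _ _),
    hΨc, integral_const] at hint
  simp only [integral_smul, hΨc, probReal_univ, one_smul] at hint
  have hE := congrArg (torusExp e) hint
  simp only [map_add, map_sum, hL, torusExp_neg_one_pow_smul, map_zero, hF,
    torusExp_torusLog] at hE
  -- This sign is why the primitive carries the factor `(-1) ^ (m + 1)`.
  have hs : ∀ a : A, (-1 : ℤ) ^ (m + 1) • (-1 : ℤ) ^ (m + 2) • a = -a := fun a => by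
    rw [smul_smul, pow_succ _ (m + 1), ← mul_assoc, ← mul_pow]
    simp
  have hE' := congrArg (fun a => (-1 : ℤ) ^ (m + 1) • a) hE
  simp only [smul_add, hs, smul_zero, Finset.smul_sum] at hE'
  rw [add_neg_eq_zero] at hE'
  rw [← hE', barDiff, smul_comm]
  congr 1
  exact Finset.sum_congr rfl fun j _ => smul_comm _ _ _

end Average

/-! ### Separability of the cochain groups -/

section Countability

/-- Measurable maps to `ℕ` fall into countably many classes, any two members of a class being
equal with high probability. -/
theorem exists_countable_code {X : Type*} [MeasurableSpace X] (μ : Measure X)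
    [IsProbabilityMeasure μ] [IsSeparable μ] {ε : ℝ≥0∞} (hε : 0 < ε) :
    ∃ c : {h : X → ℕ // Measurable h} → ℕ,
      ∀ h h', c h = c h' → μ {x | h.1 x ≠ h'.1 x} < ε := by
  obtain ⟨𝒜, h𝒜c, h𝒜⟩ := exists_countable_measureDense μ
  have : Countable 𝒜 := h𝒜c
  obtain ⟨r, hr0, hrε⟩ : ∃ r : ℝ, 0 < r ∧ ENNReal.ofReal r < ε := by
    obtain ⟨r, -, h1, h2⟩ := ENNReal.lt_iff_exists_real_btwn.1 hε
    exact ⟨r, ENNReal.ofReal_pos.1 h1, h2⟩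
  -- The code records a cutoff `N` and approximations to the level sets below it. For two functions
  -- with the same code the tail costs `r / 2`, and the `2N` approximation errors cost at most
  -- another `r / 2`.
  let P : {h : X → ℕ // Measurable h} → (Σ N : ℕ, Fin N → 𝒜) → Prop := fun h s =>
    μ {x | s.1 ≤ h.1 x} ≤ ENNReal.ofReal (r / 2) ∧
      ∀ i : Fin s.1, μ (symmDiff {x | h.1 x = i} (s.2 i)) ≤ ENNReal.ofReal (r / (4 * (s.1 + 1)))
  have hP : ∀ h, ∃ s, P h s := fun h => by
    have hlim := tendsto_measure_iInter_atTop (μ := μ) (s := fun N : ℕ => {x | N ≤ h.1 x})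
      (fun N => (measurableSet_le measurable_const h.2).nullMeasurableSet)
      (fun M N hMN x hx => le_trans hMN hx) ⟨0, measure_ne_top _ _⟩
    have hempty : ⋂ N : ℕ, {x | N ≤ h.1 x} = ∅ :=
      Set.eq_empty_of_forall_notMem fun x hx =>
        absurd (Set.mem_iInter.1 hx (h.1 x + 1)) (Nat.not_succ_le_self (h.1 x))
    rw [hempty, measure_empty] at hlim
    obtain ⟨N, hN⟩ := (hlim.eventually
      (gt_mem_nhds (ENNReal.ofReal_pos.2 (half_pos hr0)))).exists
    have hT : ∀ i : Fin N, ∃ t ∈ 𝒜,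
        μ (symmDiff {x | h.1 x = i} t) < ENNReal.ofReal (r / (4 * (N + 1))) := fun i =>
      h𝒜.approx _ (h.2 (measurableSet_singleton (i : ℕ))) (measure_ne_top _ _) _ (by positivity)
    choose t ht htμ using hT
    exact ⟨⟨N, fun i => ⟨t i, ht i⟩⟩, hN.le, fun i => (htμ i).le⟩
  choose s hs using hP
  obtain ⟨k, hk⟩ := exists_injective_nat (Σ N : ℕ, Fin N → 𝒜)
  refine ⟨fun h => k (s h), fun h h' hh => lt_of_le_of_lt ?_ hrε⟩
  have h1 := hs h
  have h2 := hs h'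
  rw [← hk hh] at h2
  generalize s h = σ at h1 h2
  have hsub : {x | h.1 x ≠ h'.1 x} ⊆ {x | σ.1 ≤ h.1 x} ∪
      ⋃ i : Fin σ.1, (symmDiff {x | h.1 x = i} (σ.2 i) ∪ symmDiff {x | h'.1 x = i} (σ.2 i)) := by
    intro x hx
    rcases le_or_gt σ.1 (h.1 x) with hle | hlt
    · exact Or.inl hle
    · refine Or.inr (Set.mem_iUnion.2 ⟨⟨h.1 x, hlt⟩, ?_⟩)
      by_cases hxt : x ∈ (σ.2 ⟨h.1 x, hlt⟩ : Set X)
      · exact Or.inr (Or.inr ⟨hxt, fun h3 => hx (Eq.symm h3)⟩)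
      · exact Or.inl (Or.inl ⟨rfl, hxt⟩)
  refine (measure_mono hsub).trans ((measure_union_le _ _).trans ?_)
  have h3 : μ (⋃ i : Fin σ.1, (symmDiff {x | h.1 x = i} (σ.2 i) ∪
      symmDiff {x | h'.1 x = i} (σ.2 i))) ≤ ENNReal.ofReal (r / 2) := by
    refine (measure_iUnion_le _).trans ?_
    rw [tsum_fintype]
    refine (Finset.sum_le_sum fun i _ => (measure_union_le _ _).trans
      (add_le_add (h1.2 i) (h2.2 i))).trans ?_
    rw [Finset.sum_const, Finset.card_univ, Fintype.card_fin, nsmul_eq_mul,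
      ← ENNReal.ofReal_add (by positivity) (by positivity), ← ENNReal.ofReal_natCast,
      ← ENNReal.ofReal_mul (by positivity)]
    refine ENNReal.ofReal_le_ofReal ?_
    have hN : (0 : ℝ) < σ.1 + 1 := by positivity
    have : (σ.1 : ℝ) * (r / (4 * (σ.1 + 1)) + r / (4 * (σ.1 + 1))) =
        r / 2 * (σ.1 / (σ.1 + 1)) := by
      field_simp
      ring
    rw [this]
    refine mul_le_of_le_one_right (by positivity) ((div_le_one hN).2 (by linarith))
  refine (add_le_add h1.1 h3).trans ?_
  rw [← ENNReal.ofReal_add (by positivity) (by positivity), add_halves]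

/-- The code of `a` is the index of the first point of a dense sequence lying near `a`; two points
near a common third have difference in `U`. -/
theorem exists_measurable_nat_code {A : Type*} [AddCommGroup A] [TopologicalSpace A]
    [IsTopologicalAddGroup A] [PolishSpace A] [MeasurableSpace A] [BorelSpace A] {U : Set A}
    (hU : U ∈ 𝓝 (0 : A)) : ∃ q : A → ℕ, Measurable q ∧ ∀ a b, q a = q b → a - b ∈ U := by
  classical
  obtain ⟨V, hV, hVU⟩ : ∃ V ∈ 𝓝 (0 : A), ∀ v ∈ V, ∀ w ∈ V, v - w ∈ U := by
    have h : Filter.Tendsto (fun z : A × A => z.1 - z.2) (𝓝 0 ×ˢ 𝓝 0) (𝓝 0) := by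
      rw [← nhds_prod_eq]
      exact (continuous_fst.sub continuous_snd).tendsto' _ _ (by simp)
    obtain ⟨V, hV, hVU⟩ := Filter.mem_prod_self_iff.1 (h hU)
    exact ⟨V, hV, fun v hv w hw => hVU (Set.mk_mem_prod hv hw)⟩
  obtain ⟨W, hWV, hWo, hW0⟩ := mem_nhds_iff.1 hV
  have hex : ∀ a : A, ∃ k, a - TopologicalSpace.denseSeq A k ∈ W := fun a => by
    obtain ⟨k, hk⟩ := (TopologicalSpace.denseRange_denseSeq A).exists_mem_open
      (hWo.preimage (continuous_const.sub continuous_id : Continuous fun b => a - b))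
      ⟨a, by simpa using hW0⟩
    exact ⟨k, hk⟩
  refine ⟨fun a => Nat.find (hex a), measurable_find hex fun k =>
    (hWo.preimage (continuous_id.sub continuous_const :
      Continuous fun a => a - TopologicalSpace.denseSeq A k)).measurableSet, fun a b hab => ?_⟩
  have ha := Nat.find_spec (hex a)
  have hb := Nat.find_spec (hex b)
  have hab' : Nat.find (hex a) = Nat.find (hex b) := hab
  rw [← hab'] at hb
  simpa using hVU _ (hWV ha) _ (hWV hb)

end Countability

/-! ### Small cocycles are coboundaries, and the conclusion -/

section Main

variable {G : Type*} [Group G] [TopologicalSpace G] [IsTopologicalGroup G] [CompactSpace G]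
  [T2Space G] [SecondCountableTopology G] [MeasurableSpace G] [BorelSpace G]
  {A : Type*} [AddCommGroup A] [TopologicalSpace A] [IsTopologicalAddGroup A] [PolishSpace A]

theorem exists_cochain_code (p : ℕ) {U : Set A} (hU : U ∈ 𝓝 (0 : A)) {ε : ℝ≥0∞} (hε : 0 < ε) :
    ∃ c : Cochain G A p → ℕ,
      ∀ φ φ', c φ = c φ' → φ - φ' ∈ smallCochains p U ε := by
  borelize A
  obtain ⟨q, hq, hqU⟩ := exists_measurable_nat_code hU
  obtain ⟨c, hc⟩ := exists_countable_code (haarPow G p) hε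
  refine ⟨fun φ => c ⟨fun g => q (φ g), hq.comp
    (AEEqFun.stronglyMeasurable (μ := haarPow G p) φ).measurable⟩, fun φ φ' h => ?_⟩
  refine (measure_mono_ae ?_).trans_lt (hc _ _ h)
  filter_upwards [AEEqFun.coeFn_sub (μ := haarPow G p) φ φ'] with g hg hgU
  have hg' : (φ - φ') g = φ g - φ' g := hg
  intro heq
  exact hgU (by rw [hg']; exact hqU _ _ heq)

variable [DistribMulAction G A] [ContinuousSMul G A]

/-- A subgroup containing a neighbourhood of `0` is open, hence closed. Chosen representatives with
the same code differ by a small cocycle, so the code is injective on cohomology classes. -/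
theorem isClopen_discrete_countable_of_small (p : ℕ) {U : Set A} (hU : U ∈ 𝓝 (0 : A))
    {ε : ℝ≥0∞} (hε : 0 < ε)
    (h : ∀ φ ∈ cocycles G A p, φ ∈ smallCochains p U ε → φ ∈ coboundaries G A p) :
    IsClopen (coboundariesInCocycles G A p : Set (cocycles G A p)) ∧
      DiscreteTopology (H G A p) ∧ Countable (H G A p) := by
  have hnhds : smallCochains p U ε ∈ 𝓝 (0 : Cochain G A p) :=
    (cochainBasis G A p).nhds_zero_hasBasis.mem_of_mem ⟨U, hU, ε, hε, rfl⟩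
  have hopen : IsOpen (coboundariesInCocycles G A p : Set (cocycles G A p)) := by
    refine AddSubgroup.isOpen_of_mem_nhds _ (g := 0) (Filter.mem_of_superset
      (continuous_subtype_val.tendsto' (0 : cocycles G A p) (0 : Cochain G A p) rfl hnhds)
      fun φ hφ => ?_)
    exact h _ φ.2 hφ
  refine ⟨⟨AddSubgroup.isClosed_of_isOpen _ hopen, hopen⟩,
    QuotientAddGroup.discreteTopology hopen, ?_⟩
  obtain ⟨c, hc⟩ := exists_cochain_code (G := G) p hU hε
  refine Function.Injective.countable (f := fun x : H G A p => c (Quotient.out x).1)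
    fun x y hxy => ?_
  have hmem : -(Quotient.out x) + Quotient.out y ∈ coboundariesInCocycles G A p := by
    have h1 := h _ (sub_mem (Quotient.out y).2 (Quotient.out x).2) (hc _ _ hxy.symm)
    rw [neg_add_eq_sub]
    exact h1
  have h2 := QuotientAddGroup.eq.2 hmem
  rw [← Quotient.out_eq x, ← Quotient.out_eq y]
  exact h2

theorem mem_coboundaries_of_ae_eq {m : ℕ} {φ : Cochain G A (m + 1)} {ψ : (Fin m → G) → A}
    (hψ : StronglyMeasurable ψ) (h : φ =ᵐ[haarPow G (m + 1)] barDiff ψ) :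
    φ ∈ coboundaries G A (m + 1) := by
  let ψ' : Cochain G A m := AEEqFun.mk (μ := haarPow G m) ψ hψ.aestronglyMeasurable
  have h1 : ψ' =ᵐ[haarPow G m] ψ := AEEqFun.coeFn_mk _ _
  exact ⟨ψ', AEEqFun.ext ((d_ae_eq G A ψ' h1).trans h.symm)⟩

theorem barDiff_ae_eq_zero {p : ℕ} {φ : Cochain G A p} (hφ : φ ∈ cocycles G A p) :
    barDiff φ =ᵐ[haarPow G (p + 1)] 0 := by
  have h : d G A p φ = 0 := hφ
  have h1 := d_ae_eq G A φ (Filter.EventuallyEq.refl _ _)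
  rw [h] at h1
  exact h1.symm.trans (AEEqFun.coeFn_zero (μ := haarPow G (p + 1)) (β := A))

theorem invariantSize_discrete (G : Type*) [Group G] {A : Type*} [AddCommGroup A]
    [TopologicalSpace A] [DiscreteTopology A] [DistribMulAction G A] :
    InvariantSize G (Set.indicator {0}ᶜ 1 : A → ℝ) where
  zero := by simp
  add_le a b := by
    by_cases ha : a = 0 <;> by_cases hb : b = 0 <;> by_cases hab : a + b = 0 <;>
      simp_all [Set.indicator]
  neg a := by by_cases ha : a = 0 <;> simp [ha]
  smul g a := by
    by_cases ha : a = 0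
    · simp [ha]
    · have hga : g • a ≠ 0 := fun h => ha ((smul_eq_zero_iff_eq g).1 h)
      simp [ha, hga]
  isClosed_le _ := isClosed_discrete _

theorem exists_small_cocycles_discrete [DiscreteTopology A] (p : ℕ) :
    ∃ U ∈ 𝓝 (0 : A), ∃ ε : ℝ≥0∞, 0 < ε ∧
      ∀ φ ∈ cocycles G A p, φ ∈ smallCochains p U ε → φ ∈ coboundaries G A p := by
  refine ⟨{0}, by simp, ?_⟩
  cases p with
  | zero =>
    -- `G ^ 0` is a single point of mass `1`, so an exceptional set of measure less than `1` is
    -- empty.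
    refine ⟨1, one_pos, fun φ _ hs => ?_⟩
    have hs' : haarPow G 0 {g | φ g ∉ ({0} : Set A)} < 1 := hs
    have h0 : ∀ g, φ g = 0 := fun g => by
      by_contra hg
      have : {g | φ g ∉ ({0} : Set A)} = Set.univ :=
        Set.eq_univ_of_forall fun g' => by rw [Subsingleton.elim g' g]; exact hg
      rw [this, measure_univ] at hs'
      exact lt_irrefl _ hs'
    have h0' : φ =ᵐ[haarPow G 0] 0 := Filter.Eventually.of_forall h0
    have h1 : φ = 0 :=
      AEEqFun.ext (h0'.trans (AEEqFun.coeFn_zero (μ := haarPow G 0) (β := A)).symm)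
    rw [h1]
    exact zero_mem _
  | succ m =>
    obtain ⟨ε, hε, D, hD⟩ := (invariantSize_discrete G (A := A)).exists_sub_barDiff_ae_le m
    refine ⟨ε, hε, fun φ hφ hs => ?_⟩
    have hs' : haarPow G (m + 1) {g | φ g ∉ ({0} : Set A)} < ε := hs
    -- With `δ = 0` the bound `D * δ` is `0`, so the almost-everywhere bound means equality with the
    -- coboundary.
    obtain ⟨ψ, hψ, h⟩ := hD φ (AEEqFun.stronglyMeasurable (μ := haarPow G (m + 1)) φ)
      (barDiff_ae_eq_zero hφ) 0 (by
        convert hs' using 2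
        ext g
        by_cases hg : φ g = 0 <;> simp [hg])
    refine mem_coboundaries_of_ae_eq hψ ?_
    filter_upwards [h] with g hg
    by_contra hne
    have hne' : (φ - barDiff ψ : (Fin (m + 1) → G) → A) g ≠ 0 := sub_ne_zero.2 hne
    rw [Set.indicator_of_mem (by exact hne')] at hg
    norm_num at hg

theorem exists_small_cocycles_toral {n : ℕ} (e : A ≃ₜ+ (Fin n → AddCircle (1 : ℝ))) (m : ℕ) :
    ∃ U ∈ 𝓝 (0 : A), ∃ ε : ℝ≥0∞, 0 < ε ∧ ∀ φ ∈ cocycles G A (m + 1),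
      φ ∈ smallCochains (m + 1) U ε → φ ∈ coboundaries G A (m + 1) := by
  obtain ⟨η, hη0, hη⟩ := exists_orbitNorm_le_of_norm_le (G := G) e (δ := 1 / 4) (by norm_num)
  obtain ⟨ε, hε, D, hD⟩ := (invariantSize_orbitNorm (G := G) e).exists_sub_barDiff_ae_le m
  -- The three bounds serve, in order, the control of orbits, the range where the covering is
  -- isometric, and a sum of `m + 3` lifted terms. Starting from `κ / (D + 1)` absorbs the loss
  -- factor `D`.
  set κ : ℝ := min (min η (1 / 2)) (1 / (2 * (m + 3))) with hκ
  have hκ0 : 0 < κ := lt_min (lt_min hη0 (by norm_num)) (by positivity)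
  have hκη : κ ≤ min η (1 / 2) := min_le_left _ _
  have hκm : (m + 3) * κ ≤ 1 / 2 := by
    calc (m + 3 : ℝ) * κ ≤ (m + 3) * (1 / (2 * (m + 3))) := by gcongr; exact min_le_right _ _
      _ = 1 / 2 := by field_simp
  have hDκ : D * (κ / (D + 1)) ≤ κ := by
    rw [mul_div_assoc', div_le_iff₀ (by positivity)]
    nlinarith
  refine ⟨{a | orbitNorm G e a ≤ κ / (D + 1)}, eventually_orbitNorm_le e (by positivity), ε, hε,
    fun φ hφ hs => ?_⟩
  have hs' : haarPow G (m + 1) {g | ¬ orbitNorm G e (φ g) ≤ κ / (D + 1)} < ε := hs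
  have hφm : StronglyMeasurable φ := AEEqFun.stronglyMeasurable (μ := haarPow G (m + 1)) φ
  obtain ⟨ψ, hψ, h⟩ := hD φ hφm (barDiff_ae_eq_zero hφ) (κ / (D + 1)) (by simpa using hs')
  obtain ⟨ψ', hψ', h'⟩ := exists_ae_eq_barDiff_of_orbitNorm_le e
    (fun a ha => hη a (ha.trans (min_le_left _ _))) (min_le_right _ _)
    (hφm.sub (stronglyMeasurable_barDiff hψ))
    (by rw [barDiff_sub_barDiff]; exact barDiff_ae_eq_zero hφ) hκη hκm
    (h.mono fun g hg => hg.trans hDκ)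
  refine mem_coboundaries_of_ae_eq (hψ.add hψ') ?_
  filter_upwards [h'] with g hg
  rw [barDiff_add, Pi.add_apply, ← hg, Pi.sub_apply]
  abel

end Main

end MeasurableCohomology

theorem mainTheorem9
    {G : Type*} [Group G] [TopologicalSpace G] [IsTopologicalGroup G] [CompactSpace G]
    [T2Space G] [SecondCountableTopology G] [MeasurableSpace G] [BorelSpace G]
    {A : Type*} [AddCommGroup A] [TopologicalSpace A] [IsTopologicalAddGroup A] [PolishSpace A]
    [DistribMulAction G A] [ContinuousSMul G A] (p : ℕ)
    (hA : DiscreteTopology A ∨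
      (1 ≤ p ∧ ∃ n : ℕ, Nonempty (A ≃ₜ+ (Fin n → AddCircle (1 : ℝ))))) :
    IsClopen (MeasurableCohomology.coboundariesInCocycles G A p :
        Set (MeasurableCohomology.cocycles G A p)) ∧
      DiscreteTopology (MeasurableCohomology.H G A p) ∧
      Countable (MeasurableCohomology.H G A p) := by
  rcases hA with hA | ⟨hp, n, ⟨e⟩⟩
  · obtain ⟨U, hU, ε, hε, h⟩ :=
      MeasurableCohomology.exists_small_cocycles_discrete (G := G) (A := A) p
    exact MeasurableCohomology.isClopen_discrete_countable_of_small p hU hε h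
  · obtain ⟨m, rfl⟩ := Nat.exists_eq_succ_of_ne_zero (by omega : p ≠ 0)
    obtain ⟨U, hU, ε, hε, h⟩ := MeasurableCohomology.exists_small_cocycles_toral (G := G) e m
    exact MeasurableCohomology.isClopen_discrete_countable_of_small _ hU hε h
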